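/- \textbf{Theorem (Criticality characterization).} Let $X$ be an infinite set and let $b:X\times X\to[0,\infty)$ be a connected graph over $X$, i.e. $b$ is symmetric, vanishes on the diagonal, satisfies $\sum_{y}b(x,y)<\infty$ for all $x$, and any two vertices are joined by a finite path $x_0,\dots,x_n$ with $b(x_i,x_{i+1})>0$. Let $q:X\to\mathbb R$, let $F(X)=\{f:X\to\mathbb R\mid \sum_y b(x,y)|f(y)|<\infty \text{ for all }x\}$, and put \[ Hf(x)=\sum_{y}b(x,y)(f(x)-f(y))+q(x)f(x),\qquad f\in F(X), \] \[ h(\varphi,\psi)=\tfrac12\sum_{x,y}b(x,y)(\varphi(x)-\varphi(y))(\psi(x)-\psi(y))+\sum_x q(x)\varphi(x)\psi(x),\qquad h(\varphi)=h(\varphi,\varphi), \] for $\varphi,\psi$ in the space $C_c(X)$ of finitely supported real functions. Assume $h(\varphi)\ge 0$ for all $\varphi\in C_c(X)$. A function $f$ on $X$ is called \emph{positive} if $f\ge0$ and $f\ne0$. A function $u$ is \emph{$H$-superharmonic} (\emph{$H$-harmonic}) if $u\in F(X)$ and $Hu\ge0$ ($Hu=0$) on $X$. The form $h$ is \emph{subcritical}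 if there is a positive $w:X\to\mathbb R$ with $h(\varphi)-\sum_x w(x)\varphi(x)^2\ge0$ for all $\varphi\in C_c(X)$, and \emph{critical} otherwise. A \emph{null-sequence} is a sequence $(e_n)$ of positive functions in $C_c(X)$ with $h(e_n)\to0$ such that for some $o\in X$ and $c>0$ one has $e_n(o)=c$ for all $n$. Let $H^{(1)}$ be the self-adjoint operator on $\ell^2(X)$ (counting measure) associated with the closure of $h$ in $\ell^2(X)$, and let $1_{\{x\}}$ be the characteristic function of $\{x\}$. Then the following are equivalent: \begin{itemize} \item[(i)] $h$ is critical. \item[(ii)] $\lim_{\lambda\nearrow0}(H^{(1)}-\lambda)^{-1}1_{\{x\}}(y)=\infty$ for some (equivalently, for all) $x,y\in X$. \item[(ii')] $\lim_{t\to\infty}\int_0^t e^{-sH^{(1)}}1_{\{x\}}(y)\,ds=\infty$ for some (equivalently, for all) $x,y\in X$. \item[(iii)] There exists a positive $H$-superharmonic function, and it is unique up to scalar multiples. \item[(iii')] Every linearly independent set of positive $H$-superharmonic functions is finite. \item[(iv)] For all $o\in X$ and $c>0$ there is a null-sequence $(e_n)$ with $e_n(o)=c$ for all $n$. \item[(iv')]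 There are a positive $H$-harmonic function $v$ and a null-sequence $(e_n)$ with $0\le e_n\le v$ for all $n$ and $e_n(x)\to v(x)$ for all $x\in X$. \item[(v)] $\mathrm{cap}_h(\{x\}):=\inf\{h(\varphi)\mid\varphi\in C_c(X),\ \varphi(x)=1\}=0$ for all $x\in X$. \end{itemize} If one of these conditions holds, then the positive $H$-superharmonic function, which is unique up to scaling by positive constants, is $H$-harmonic. -/

import Mathlib

open Filter Topology

noncomputable section

/-- A graph over the discrete set `X`: a symmetric, locally summable weight
`b : X × X → [0, ∞)` with zero diagonal. -/
structure WeightedGraph (X : Type*) where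
  b : X → X → ℝ
  nonneg : ∀ x y, 0 ≤ b x y
  symm : ∀ x y, b x y = b y x
  diag : ∀ x, b x x = 0
  summable : ∀ x, Summable (b x)

/-- A positive function: `f ≥ 0` and `f ≠ 0`. -/
def IsPositiveFun {X : Type*} (f : X → ℝ) : Prop :=
  (∀ x, 0 ≤ f x) ∧ f ≠ 0

/-- The real Hilbert space `ℓ²(X)` with respect to the counting measure. -/
abbrev EllTwo (X : Type*) : Type _ := lp (fun _ : X => ℝ) 2

theorem memlp_two_of_finsupp {X : Type*} (φ : X →₀ ℝ) :
    Memℓp (fun x => φ x) 2 := by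
  apply memℓp_gen
  apply summable_of_hasFiniteSupport
  refine φ.hasFiniteSupport.subset fun x hx => ?_
  simp only [Function.mem_support] at hx ⊢
  intro h0
  apply hx
  simp [h0]

/-- The inclusion `C_c(X) ⊆ ℓ²(X)`; finitely supported functions are elements of `X →₀ ℝ`. -/
def toEllTwo {X : Type*} (φ : X →₀ ℝ) : EllTwo X :=
  ⟨fun x => φ x, memlp_two_of_finsupp φ⟩

namespace WeightedGraph

variable {X : Type*} (G : WeightedGraph X) (q : X → ℝ)

/-- `x ∼ y`. -/
def Adj (x y : X) : Prop := 0 < G.b x y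

/-- Any two vertices are joined by a finite path of adjacent vertices. -/
def Connected : Prop := ∀ x y, Relation.ReflTransGen G.Adj x y

/-- The function space `F(X)`. -/
def MemF (f : X → ℝ) : Prop := ∀ x, Summable fun y => G.b x y * |f y|

/-- The formal Laplacian `L`. -/
def laplacian (f : X → ℝ) (x : X) : ℝ := ∑' y, G.b x y * (f x - f y)

/-- The formal Schrödinger operator `H = L + q`. -/
def schrodinger (f : X → ℝ) (x : X) : ℝ := G.laplacian f x + q x * f x

/-- `u` is `H`-harmonic on `X`. -/
def IsHarmonic (u : X → ℝ) : Prop := G.MemF u ∧ ∀ x, G.schrodinger q u x = 0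

/-- `u` is `H`-superharmonic on `X`. -/
def IsSuperharmonic (u : X → ℝ) : Prop := G.MemF u ∧ ∀ x, 0 ≤ G.schrodinger q u x

/-- `u` is a positive `H`-superharmonic function on `X`. -/
def IsPosSuperharmonic (u : X → ℝ) : Prop := IsPositiveFun u ∧ G.IsSuperharmonic q u

/-- The bilinear form `h(φ, ψ)` on `C_c(X) × C_c(X)`. -/
def form (φ ψ : X →₀ ℝ) : ℝ :=
  1 / 2 * ∑' p : X × X, G.b p.1 p.2 * (φ p.1 - φ p.2) * (ψ p.1 - ψ p.2)
    + ∑' x, q x * φ x * ψ x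

/-- `h ≥ 0` on `C_c(X)`. -/
def FormNonneg : Prop := ∀ φ : X →₀ ℝ, 0 ≤ G.form q φ φ

/-- `h` is subcritical: there is a positive function `w` with `h - w ≥ 0` on `C_c(X)`. -/
def Subcritical : Prop :=
  ∃ w : X → ℝ, IsPositiveFun w ∧ ∀ φ : X →₀ ℝ, 0 ≤ G.form q φ φ - ∑' x, w x * φ x ^ 2

/-- `h` is critical (for `h ≥ 0`): it is not subcritical. -/
def Critical : Prop := ¬ G.Subcritical q

/-- `(e n)` is a null-sequence of `h`. -/
def IsNullSequence (e : ℕ → X →₀ ℝ) : Prop :=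
  (∀ n, IsPositiveFun (e n)) ∧ (∃ o : X, ∃ c : ℝ, 0 < c ∧ ∀ n, e n o = c) ∧
    Tendsto (fun n => G.form q (e n) (e n)) atTop (𝓝 0)

/-- The capacity `cap_h({x})`. -/
def capacity (x : X) : ℝ := sInf {r | ∃ φ : X →₀ ℝ, φ x = 1 ∧ r = G.form q φ φ}

/-! ### The closure of `h` in `ℓ²(X)` and the associated self-adjoint operator -/

/-- `(φ n)` is a sequence in `C_c(X)` that is Cauchy with respect to `h` and converges to `f`
in `ℓ²(X)` (so that it is Cauchy with respect to the form norm `(h(·) + ‖·‖²)^{1/2}`). -/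
def IsFormApprox (φ : ℕ → X →₀ ℝ) (f : EllTwo X) : Prop :=
  Tendsto (fun n => toEllTwo (φ n)) atTop (𝓝 f) ∧
    Tendsto (fun p : ℕ × ℕ => G.form q (φ p.1 - φ p.2) (φ p.1 - φ p.2)) atTop (𝓝 0)

/-- The domain of the closure `h^{(1)}`. -/
def formDomain : Set (EllTwo X) := {f | ∃ φ, G.IsFormApprox q φ f}

open Classical in
/-- The closure `h^{(1)}` of `h`: the limit of `h(φ n, ψ n)` along approximating sequences. As
nonnegative forms `h` are closable, the limit exists and does not depend on the sequences. -/
def closedForm (f g : EllTwo X) : ℝ :=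
  if hfg : f ∈ G.formDomain q ∧ g ∈ G.formDomain q then
    limUnder atTop fun n => G.form q (hfg.1.choose n) (hfg.2.choose n)
  else 0

/-- The graph of the self-adjoint operator `H^{(1)}` associated with `h^{(1)}`: the relation
`f ∈ D(H^{(1)})` and `H^{(1)} f = g`. -/
def IsOperatorValue (f g : EllTwo X) : Prop :=
  f ∈ G.formDomain q ∧ ∀ k ∈ G.formDomain q, G.closedForm q f k = inner ℝ g k

open Classical in
/-- The resolvent: `(H^{(1)} - lam)⁻¹ f` is the `u ∈ D(H^{(1)})` with `H^{(1)} u - lam u = f`. -/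
def resolvent (lam : ℝ) (f : EllTwo X) : EllTwo X :=
  if hu : ∃ u, G.IsOperatorValue q u (f + lam • u) then hu.choose else 0

/-- `(T t)`, `t ≥ 0`, is the strongly continuous semigroup on `ℓ²(X)` with generator
`-H^{(1)}` (including equality of the domains). -/
structure IsHeatSemigroup (T : ℝ → EllTwo X →L[ℝ] EllTwo X) : Prop where
  zero : T 0 = ContinuousLinearMap.id ℝ (EllTwo X)
  add : ∀ s t, 0 ≤ s → 0 ≤ t → T (s + t) = (T s).comp (T t)
  continuousOn : ∀ f, ContinuousOn (fun t => T t f) (Set.Ici 0)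
  generator : ∀ f g,
    HasDerivWithinAt (fun t => T t f) (-g) (Set.Ici 0) 0 ↔ G.IsOperatorValue q f g

open Classical in
/-- The semigroup `e^{-t H^{(1)}}`, `t ≥ 0`. -/
def heatSemigroup : ℝ → EllTwo X →L[ℝ] EllTwo X :=
  if hT : ∃ T, G.IsHeatSemigroup q T then hT.choose else 0

/-- `(H^{(1)} - lam)⁻¹ 1_{x} (y)`. -/
def resolventKernel (lam : ℝ) (x y : X) : ℝ :=
  G.resolvent q lam (toEllTwo (Finsupp.single x 1)) y

/-- `e^{-t H^{(1)}} 1_{x} (y)`. -/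
def heatKernel (t : ℝ) (x y : X) : ℝ :=
  G.heatSemigroup q t (toEllTwo (Finsupp.single x 1)) y

end WeightedGraph

end

open Filter Topology

noncomputable section

/-! The equivalences revolve around one quantity: the best constant `c` with `c φ(x)² ≤ h(φ)` on
`C_c(X)`. A positive weight dominates a multiple of a point mass, so subcriticality means `c > 0` at
some vertex (`subcritical_iff`); by scaling, `c` is the capacity. The Green function `G_α(x,·) =
(H⁽¹⁾ + α)⁻¹ 1_{x}` is the reproducing kernel of `h + α‖·‖²`, so Cauchy–Schwarz gives `c > 0`
exactly when `G_α(x,x)` stays bounded as `α ↘ 0` (`pointBound_iff_greenBounded`). Since `G_α` is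
monotone in `α` and is the Laplace transform of the heat kernel, this yields (ii) and (ii').
Harnack's inequality carries boundedness from one pair of vertices to all others, whence "for some"
equals "for all".

Positive superharmonic functions `u` always exist, as limits of normalised Green functions. For `φ =
uψ` the ground state representation writes `h(φ)` as `∑ (Hu) u ψ²` plus half the sum of `b(x,y) u(x)
u(y) (ψ(x) - ψ(y))²`. If `Hu(x) > 0`, the first term is a point bound; hence `u` is harmonic in the
critical case. If `h(e_n) → 0`, the second term forces `e_n / u` to become constant along edges, so
a null-sequence with a fixed value at one vertex converges to a multiple of every positive
superharmonic function. This gives uniqueness, and truncation at `u` gives (iv'). In the subcritical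
case the `G_α(x,·)` increase to `g_x` with `H g_x = 1_{x}`; these are linearly independent, so
(iii') fails on an infinite set.

The operator side is built from scratch. `H` maps `C_c(X)` into `ℓ²(X)`, so `h` is closable and
`H⁽¹⁾` can be tested on `C_c(X)`. Resolvents arise by minimisation, the semigroup by Yosida
approximation. Positivity of both descends from `h(|φ|) ≤ h(φ)`. -/

/-- The inclusion `C_c(X) ⊆ ℓ²(X)` as a linear map. -/
def ellTwoIncl (X : Type*) : (X →₀ ℝ) →ₗ[ℝ] EllTwo X where
  toFun := toEllTwo
  map_add' _ _ := rfl
  map_smul' _ _ := rfl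

theorem toEllTwo_eq {X : Type*} (φ : X →₀ ℝ) : toEllTwo φ = ellTwoIncl X φ := rfl

@[simp]
theorem ellTwoIncl_apply {X : Type*} (φ : X →₀ ℝ) (x : X) : ellTwoIncl X φ x = φ x := rfl

theorem inner_ellTwoIncl {X : Type*} (f : EllTwo X) (φ : X →₀ ℝ) :
    inner ℝ f (ellTwoIncl X φ) = φ.sum fun x a => f x * a := by
  rw [lp.inner_eq_tsum, tsum_eq_sum (s := φ.support)]
  · exact Finset.sum_congr rfl fun x _ => by simp [mul_comm]
  · intro x hx
    simp [Finsupp.notMem_support_iff.1 hx]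

theorem inner_ellTwoIncl_single {X : Type*} (f : EllTwo X) (x : X) (a : ℝ) :
    inner ℝ f (ellTwoIncl X (Finsupp.single x a)) = f x * a := by
  rw [inner_ellTwoIncl, Finsupp.sum_single_index (by simp)]

theorem ellTwo_eq_of_inner {X : Type*} {f g : EllTwo X}
    (h : ∀ φ : X →₀ ℝ, inner ℝ f (ellTwoIncl X φ) = inner ℝ g (ellTwoIncl X φ)) : f = g := by
  ext x
  simpa [inner_ellTwoIncl_single] using h (Finsupp.single x 1)

/-- Only the finitely many rows over the support of `ψ` contribute, so summability of each single
row suffices. -/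
theorem hasSum_fst_finsupp {X : Type*} {g : X → X → ℝ} (hg : ∀ x, Summable (g x))
    (ψ : X →₀ ℝ) :
    HasSum (fun p : X × X => g p.1 p.2 * ψ p.1) (ψ.sum fun x a => (∑' y, g x y) * a) := by
  classical
  have key : ∀ x ∈ ψ.support, HasSum (fun p : X × X => if p.1 = x then g x p.2 * ψ x else 0)
      ((∑' y, g x y) * ψ x) := by
    intro x _
    have hinj : Function.Injective (fun y : X => (x, y)) := fun a b h => by simpa using h
    rw [← hinj.hasSum_iff]
    · simpa [Function.comp_def] using (hg x).hasSum.mul_right (ψ x)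
    · rintro ⟨a, b⟩ hab
      simp only [ite_eq_right_iff]
      rintro rfl
      exact absurd ⟨b, rfl⟩ hab
  refine (hasSum_sum key).congr_fun ?_
  intro p
  by_cases hp : p.1 ∈ ψ.support
  · simp only [Finset.sum_ite_eq, if_pos hp]
  · simp only [Finset.sum_ite_eq, if_neg hp, Finsupp.notMem_support_iff.1 hp, mul_zero]

/-! ### Green's formula and the action of `H` on `C_c(X)` -/

namespace WeightedGraph

variable {X : Type*} (G : WeightedGraph X) (q : X → ℝ)

/-- The weighted vertex degree. -/
def deg (x : X) : ℝ := ∑' y, G.b x y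

variable {G} in
theorem MemF.summable {f : X → ℝ} (hf : G.MemF f) (x : X) : Summable fun y => G.b x y * f y := by
  refine Summable.of_norm ?_
  convert hf x using 2 with y
  rw [norm_mul, Real.norm_of_nonneg (G.nonneg x y), Real.norm_eq_abs]

variable {G} in
theorem MemF.summable_sub {f : X → ℝ} (hf : G.MemF f) (x : X) :
    Summable fun y => G.b x y * (f x - f y) := by
  simp only [mul_sub]
  exact ((G.summable x).mul_right _).sub (hf.summable x)

theorem memF_finsupp (φ : X →₀ ℝ) : G.MemF φ := by
  intro x
  apply summable_of_hasFiniteSupport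
  refine φ.hasFiniteSupport.subset fun y hy => ?_
  simp only [Function.mem_support] at hy ⊢
  contrapose! hy
  simp [hy]

variable {G} in
theorem MemF.laplacian_eq {f : X → ℝ} (hf : G.MemF f) (x : X) :
    G.laplacian f x = G.deg x * f x - ∑' y, G.b x y * f y := by
  simp only [laplacian, mul_sub, deg]
  rw [((G.summable x).mul_right _).tsum_sub (hf.summable x), tsum_mul_right]

variable {G} in
theorem MemF.schrodinger_eq {f : X → ℝ} (hf : G.MemF f) (x : X) :
    G.schrodinger q f x = (G.deg x + q x) * f x - ∑' y, G.b x y * f y := by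
  rw [schrodinger, hf.laplacian_eq]; ring

variable {G} in
/-- Green's formula. -/
theorem MemF.hasSum_green {f : X → ℝ} (hf : G.MemF f) (ψ : X →₀ ℝ) :
    HasSum (fun p : X × X => G.b p.1 p.2 * (f p.1 - f p.2) * (ψ p.1 - ψ p.2))
      (2 * ψ.sum fun x a => G.laplacian f x * a) := by
  have h1 := hasSum_fst_finsupp (fun x => hf.summable_sub x) ψ
  -- Exchanging the two coordinates turns the `ψ p.2` half of the edge sum into a second copy of the
  -- `ψ p.1` half; hence the factor 2.
  have h2 := (Equiv.prodComm X X).hasSum_iff.2 h1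
  have h3 := h1.add h2
  rw [← two_mul] at h3
  refine h3.congr_fun fun p => ?_
  simp only [Function.comp_apply, Equiv.prodComm_apply, Prod.fst_swap, Prod.snd_swap]
  rw [G.symm p.2 p.1]
  ring

theorem tsum_mul_finsupp (g : X → ℝ) (ψ : X →₀ ℝ) :
    ∑' x, g x * ψ x = ψ.sum fun x a => g x * a := by
  rw [tsum_eq_sum (s := ψ.support)]
  · rfl
  · intro x hx
    simp [Finsupp.notMem_support_iff.1 hx]

theorem form_eq_sum (φ ψ : X →₀ ℝ) :
    G.form q φ ψ = ψ.sum fun x a => G.schrodinger q φ x * a := by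
  rw [form, ((G.memF_finsupp φ).hasSum_green ψ).tsum_eq, tsum_mul_finsupp (fun x => q x * φ x)]
  simp only [schrodinger, Finsupp.sum, add_mul, Finset.sum_add_distrib]
  ring

/-- For the counting measure `ℓ¹ ⊆ ℓ²`, so local summability alone ensures that `H` maps `C_c(X)`
into `ℓ²(X)`. -/
theorem memℓp_b (x : X) : Memℓp (G.b x) 2 := by
  have h : Memℓp (G.b x) 1 := by
    apply memℓp_gen
    simpa [abs_of_nonneg (G.nonneg x _)] using G.summable x
  exact h.of_exponent_ge (by norm_num)

/-- The function `H 1_{x}` as an element of `ℓ²(X)`. -/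
def opColumn (x : X) : EllTwo X :=
  toEllTwo (Finsupp.single x (G.deg x + q x)) - ⟨G.b x, G.memℓp_b x⟩

/-- The operator `H` on `C_c(X)`, with values in `ℓ²(X)`. -/
def opEll : (X →₀ ℝ) →ₗ[ℝ] EllTwo X := Finsupp.linearCombination ℝ (G.opColumn q)

theorem opColumn_apply (x y : X) :
    G.opColumn q x y = Finsupp.single x (G.deg x + q x) y - G.b x y := rfl

theorem opEll_apply (φ : X →₀ ℝ) (x : X) : G.opEll q φ x = G.schrodinger q φ x := by
  rw [(G.memF_finsupp φ).schrodinger_eq, tsum_mul_finsupp, opEll, Finsupp.linearCombination_apply,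
    Finsupp.sum, lp.coeFn_sum, Finset.sum_apply]
  simp only [lp.coeFn_smul, Pi.smul_apply, smul_eq_mul, opColumn_apply, mul_sub,
    Finset.sum_sub_distrib]
  congr 1
  · rw [Finset.sum_eq_single x]
    · simp [mul_comm]
    · intro y _ hy
      simp [Finsupp.single_eq_of_ne hy.symm]
    · intro hx
      simp [Finsupp.notMem_support_iff.1 hx]
  · exact Finset.sum_congr rfl fun y _ => by rw [G.symm, mul_comm]

/-- Pairing with `H 1_{x}` evaluates `H f` at `x` even when `f` is merely in `ℓ²(X)`; this turns
weak equations into pointwise ones. -/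
theorem inner_opColumn (f : EllTwo X) (x : X) :
    (Summable fun y => G.b x y * f y) ∧
      inner ℝ f (G.opColumn q x) = (G.deg x + q x) * f x - ∑' y, G.b x y * f y := by
  have hs := lp.hasSum_inner (𝕜 := ℝ) f (⟨G.b x, G.memℓp_b x⟩ : EllTwo X)
  have hs' : HasSum (fun y => G.b x y * f y) (inner ℝ f (⟨G.b x, G.memℓp_b x⟩ : EllTwo X)) :=
    hs.congr_fun fun y => by simp
  refine ⟨hs'.summable, ?_⟩
  rw [opColumn, inner_sub_right, hs'.tsum_eq, toEllTwo_eq, inner_ellTwoIncl_single, mul_comm]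

theorem opEll_single (x : X) : G.opEll q (Finsupp.single x 1) = G.opColumn q x := by
  simp [opEll]

/-- For fixed `φ` the form is `ℓ²`-continuous in `ψ`, which is the source of closability. -/
theorem form_eq_inner (φ ψ : X →₀ ℝ) :
    G.form q φ ψ = inner ℝ (G.opEll q φ) (ellTwoIncl X ψ) := by
  rw [form_eq_sum, inner_ellTwoIncl]
  simp only [opEll_apply]

theorem form_comm (φ ψ : X →₀ ℝ) : G.form q φ ψ = G.form q ψ φ := by
  simp only [form]
  congr 2
  · congr 1; ext p; ring
  · ext p; ring

theorem form_eq_inner' (φ ψ : X →₀ ℝ) :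
    G.form q φ ψ = inner ℝ (ellTwoIncl X φ) (G.opEll q ψ) := by
  rw [form_comm, form_eq_inner, real_inner_comm]

/-- The bilinear form `h` as a bilinear map. -/
def formBilin : LinearMap.BilinForm ℝ (X →₀ ℝ) :=
  (innerₗ (EllTwo X)).compl₁₂ (G.opEll q) (ellTwoIncl X)

theorem formBilin_apply (φ ψ : X →₀ ℝ) : G.formBilin q φ ψ = G.form q φ ψ := by
  simp [formBilin, form_eq_inner]

theorem form_add_left (φ φ' ψ : X →₀ ℝ) :
    G.form q (φ + φ') ψ = G.form q φ ψ + G.form q φ' ψ := by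
  simp [← formBilin_apply]

theorem form_add_right (φ ψ ψ' : X →₀ ℝ) :
    G.form q φ (ψ + ψ') = G.form q φ ψ + G.form q φ ψ' := by
  simp [← formBilin_apply]

theorem form_sub_left (φ φ' ψ : X →₀ ℝ) :
    G.form q (φ - φ') ψ = G.form q φ ψ - G.form q φ' ψ := by
  simp [← formBilin_apply]

theorem form_sub_right (φ ψ ψ' : X →₀ ℝ) :
    G.form q φ (ψ - ψ') = G.form q φ ψ - G.form q φ ψ' := by
  simp [← formBilin_apply]

theorem form_smul_left (a : ℝ) (φ ψ : X →₀ ℝ) : G.form q (a • φ) ψ = a * G.form q φ ψ := by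
  simp [← formBilin_apply]

theorem form_smul_right (a : ℝ) (φ ψ : X →₀ ℝ) : G.form q φ (a • ψ) = a * G.form q φ ψ := by
  simp [← formBilin_apply]

theorem form_zero_left (ψ : X →₀ ℝ) : G.form q 0 ψ = 0 := by
  simp [← formBilin_apply]

variable {G q}

theorem FormNonneg.sq_le (hq : G.FormNonneg q) (φ ψ : X →₀ ℝ) :
    G.form q φ ψ ^ 2 ≤ G.form q φ φ * G.form q ψ ψ := by
  have := (G.formBilin q).apply_mul_apply_le_of_forall_zero_le
    (fun φ => by rw [formBilin_apply]; exact hq φ) φ ψ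
  simpa only [formBilin_apply, form_comm G q ψ φ, ← sq] using this

/-- The seminorm `h(·)^{1/2}`. -/
def formNorm (G : WeightedGraph X) (q : X → ℝ) (φ : X →₀ ℝ) : ℝ := √(G.form q φ φ)

theorem formNorm_nonneg (φ : X →₀ ℝ) : 0 ≤ G.formNorm q φ := Real.sqrt_nonneg _

theorem FormNonneg.sq_formNorm (hq : G.FormNonneg q) (φ : X →₀ ℝ) :
    G.formNorm q φ ^ 2 = G.form q φ φ := Real.sq_sqrt (hq φ)

theorem FormNonneg.abs_form_le (hq : G.FormNonneg q) (φ ψ : X →₀ ℝ) :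
    |G.form q φ ψ| ≤ G.formNorm q φ * G.formNorm q ψ := by
  refine abs_le_of_sq_le_sq ?_ (mul_nonneg (formNorm_nonneg _) (formNorm_nonneg _))
  rw [mul_pow, hq.sq_formNorm, hq.sq_formNorm]
  exact hq.sq_le φ ψ

theorem FormNonneg.formNorm_add_le (hq : G.FormNonneg q) (φ ψ : X →₀ ℝ) :
    G.formNorm q (φ + ψ) ≤ G.formNorm q φ + G.formNorm q ψ := by
  refine (abs_le_of_sq_le_sq' ?_ (add_nonneg (formNorm_nonneg _) (formNorm_nonneg _))).2
  have := (abs_le.1 (hq.abs_form_le φ ψ)).2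
  rw [hq.sq_formNorm, add_sq, hq.sq_formNorm, hq.sq_formNorm, form_add_left, form_add_right,
    form_add_right, form_comm G q ψ φ]
  linarith

theorem formNorm_sub_comm (φ ψ : X →₀ ℝ) : G.formNorm q (φ - ψ) = G.formNorm q (ψ - φ) := by
  rw [formNorm, formNorm]
  congr 1
  simp only [form_sub_left, form_sub_right]
  ring

theorem FormNonneg.abs_formNorm_sub_le (hq : G.FormNonneg q) (φ ψ : X →₀ ℝ) :
    |G.formNorm q φ - G.formNorm q ψ| ≤ G.formNorm q (φ - ψ) := by
  have h1 := hq.formNorm_add_le (φ - ψ) ψ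
  have h2 := hq.formNorm_add_le (ψ - φ) φ
  rw [formNorm_sub_comm] at h2
  simp only [sub_add_cancel] at h1 h2
  rw [abs_le]
  constructor <;> linarith

/-! ### Ground state representation and absolute values -/

variable (G q)

variable {G} in
/-- Ground state representation. -/
theorem MemF.hasSum_groundState {u : X → ℝ} (hu : G.MemF u) {φ ψ : X →₀ ℝ}
    (h : ∀ x, φ x = u x * ψ x) :
    HasSum (fun p : X × X => G.b p.1 p.2 * (u p.1 * u p.2) * (ψ p.1 - ψ p.2) ^ 2)
      (2 * (G.form q φ φ - ∑' x, G.schrodinger q u x * u x * ψ x ^ 2)) := by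
  -- Green's formula for `φ` against itself minus Green's formula for `u` against `u ψ²`: the
  -- potential terms cancel and each edge leaves a perfect square. No sign of `u` is needed.
  have hχ : ∃ χ : X →₀ ℝ, ∀ x, χ x = u x * ψ x ^ 2 :=
    ⟨Finsupp.onFinset ψ.support (fun x => u x * ψ x ^ 2) fun x hx => by
      rw [Finsupp.mem_support_iff]; rintro h0; simp [h0] at hx, fun x => rfl⟩
  obtain ⟨χ, hχ⟩ := hχ
  have h1 := (G.memF_finsupp φ).hasSum_green φ
  have h2 := hu.hasSum_green χ
  have h3 : G.form q φ φ = (φ.sum fun x a => G.laplacian φ x * a) + ∑' x, q x * φ x * φ x := by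
    rw [form, h1.tsum_eq]; ring
  have h4 : ∑' x, G.schrodinger q u x * u x * ψ x ^ 2 =
      (χ.sum fun x a => G.laplacian u x * a) + ∑' x, q x * φ x * φ x := by
    have h5 : ∀ x, G.schrodinger q u x * u x * ψ x ^ 2 =
        G.laplacian u x * χ x + q x * u x * χ x := by
      intro x; rw [hχ, schrodinger]; ring
    have h6 : ∀ x, q x * φ x * φ x = q x * u x * χ x := by
      intro x; rw [hχ, h]; ring
    have hsum : ∀ g : X → ℝ, Summable fun x => g x * χ x := fun g =>
      summable_of_hasFiniteSupport (χ.hasFiniteSupport.subset fun x hx => by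
        simp only [Function.mem_support] at hx ⊢; contrapose! hx; simp [hx])
    simp only [h5, h6]
    rw [(hsum _).tsum_add (hsum _), tsum_mul_finsupp (G.laplacian u)]
  rw [h3, h4, add_sub_add_right_eq_sub, mul_sub]
  refine (h1.sub h2).congr_fun fun p => ?_
  rw [h, h, hχ, hχ]
  ring

/-- The absolute value of a finitely supported function. -/
def absFinsupp (φ : X →₀ ℝ) : X →₀ ℝ := φ.mapRange (fun t => |t|) abs_zero

@[simp]
theorem absFinsupp_apply (φ : X →₀ ℝ) (x : X) : absFinsupp φ x = |φ x| := rfl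

/-- The reverse triangle inequality lowers every edge term, while the potential term depends only on
`φ²`. -/
theorem form_absFinsupp_le (φ : X →₀ ℝ) :
    G.form q (absFinsupp φ) (absFinsupp φ) ≤ G.form q φ φ := by
  simp only [form]
  have h : ∑' x, q x * absFinsupp φ x * absFinsupp φ x = ∑' x, q x * φ x * φ x := by
    congr 1; ext x; rw [absFinsupp_apply, mul_assoc, abs_mul_abs_self, mul_assoc]
  rw [h]
  gcongr 1 / 2 * ?_ + _
  refine ((G.memF_finsupp _).hasSum_green _).summable.tsum_le_tsum ?_
    ((G.memF_finsupp _).hasSum_green _).summable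
  intro p
  rw [mul_assoc, mul_assoc]
  refine mul_le_mul_of_nonneg_left ?_ (G.nonneg _ _)
  rw [← sq, ← sq, sq_le_sq]
  exact abs_abs_sub_abs_le_abs_sub _ _

end WeightedGraph

/-! ### Closability, the closed form and its operator -/

namespace WeightedGraph

variable {X : Type*} {G : WeightedGraph X} {q : X → ℝ}

theorem isFormApprox_iff (hq : G.FormNonneg q) {φ : ℕ → X →₀ ℝ} {f : EllTwo X} :
    G.IsFormApprox q φ f ↔ Tendsto (fun n => ellTwoIncl X (φ n)) atTop (𝓝 f) ∧
      Tendsto (fun p : ℕ × ℕ => G.formNorm q (φ p.1 - φ p.2)) atTop (𝓝 0) := by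
  refine and_congr Iff.rfl ⟨fun h => ?_, fun h => ?_⟩
  · simpa [Function.comp_def, formNorm] using (Real.continuous_sqrt.tendsto 0).comp h
  · simpa [hq.sq_formNorm] using h.pow 2

theorem isFormApprox_const (φ : X →₀ ℝ) :
    G.IsFormApprox q (fun _ => φ) (ellTwoIncl X φ) := by
  refine ⟨tendsto_const_nhds, ?_⟩
  simp [form_zero_left]

theorem FormNonneg.isFormApprox_add (hq : G.FormNonneg q) {φ ψ : ℕ → X →₀ ℝ} {f g : EllTwo X}
    (hφ : G.IsFormApprox q φ f) (hψ : G.IsFormApprox q ψ g) :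
    G.IsFormApprox q (fun n => φ n + ψ n) (f + g) := by
  rw [isFormApprox_iff hq] at *
  refine ⟨by simpa using hφ.1.add hψ.1, ?_⟩
  refine squeeze_zero (fun _ => formNorm_nonneg _) (fun p => ?_)
    (by simpa using hφ.2.add hψ.2)
  rw [add_sub_add_comm]
  exact hq.formNorm_add_le _ _

theorem isFormApprox_smul {φ : ℕ → X →₀ ℝ} {f : EllTwo X}
    (a : ℝ) (hφ : G.IsFormApprox q φ f) :
    G.IsFormApprox q (fun n => a • φ n) (a • f) := by
  refine ⟨by simpa [toEllTwo_eq] using hφ.1.const_smul a, ?_⟩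
  simpa [← smul_sub, form_smul_left, form_smul_right] using (hφ.2.const_mul a).const_mul a

theorem FormNonneg.isFormApprox_sub (hq : G.FormNonneg q) {φ ψ : ℕ → X →₀ ℝ} {f g : EllTwo X}
    (hφ : G.IsFormApprox q φ f) (hψ : G.IsFormApprox q ψ g) :
    G.IsFormApprox q (fun n => φ n - ψ n) (f - g) := by
  simpa [sub_eq_add_neg] using hq.isFormApprox_add hφ (isFormApprox_smul (-1) hψ)

theorem FormNonneg.exists_tendsto_formNorm (hq : G.FormNonneg q) {φ : ℕ → X →₀ ℝ} {f : EllTwo X}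
    (hφ : G.IsFormApprox q φ f) : ∃ L, Tendsto (fun n => G.formNorm q (φ n)) atTop (𝓝 L) := by
  rw [isFormApprox_iff hq] at hφ
  apply cauchySeq_tendsto_of_complete
  rw [cauchySeq_iff_tendsto_dist_atTop_0]
  exact squeeze_zero (fun _ => dist_nonneg) (fun p => hq.abs_formNorm_sub_le _ _) hφ.2

/-- The form `h` is closable. -/
theorem FormNonneg.tendsto_formNorm_zero (hq : G.FormNonneg q) {φ : ℕ → X →₀ ℝ}
    (hφ : G.IsFormApprox q φ 0) : Tendsto (fun n => G.formNorm q (φ n)) atTop (𝓝 0) := by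
  rw [isFormApprox_iff hq] at hφ
  rw [Metric.tendsto_atTop]
  intro ε hε
  obtain ⟨N, hN⟩ := eventually_atTop.1 (hφ.2.eventually_lt_const (half_pos hε))
  have hN' : ∀ n ≥ N.1 + N.2, ∀ m ≥ N.1 + N.2, G.formNorm q (φ n - φ m) < ε / 2 := fun n hn m hm =>
    hN (n, m) ⟨by simp; omega, by simp; omega⟩
  refine ⟨N.1 + N.2, fun n hn => ?_⟩
  rw [Real.dist_eq, sub_zero, abs_of_nonneg (formNorm_nonneg _)]
  -- Split `h(φ n) = h(φ n, φ n - φ m) + ⟨H φ n, φ m⟩`: the Cauchy property controls the first term,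
  -- and the second vanishes as `m → ∞` with `n` fixed.
  have h1 : ∀ᶠ m in atTop, G.formNorm q (φ n) ^ 2 ≤
      G.formNorm q (φ n) * (ε / 2) + inner ℝ (G.opEll q (φ n)) (ellTwoIncl X (φ m)) := by
    filter_upwards [eventually_ge_atTop (N.1 + N.2)] with m hm
    have h2 := (abs_le.1 (hq.abs_form_le (φ n) (φ n - φ m))).2
    have h3 := mul_le_mul_of_nonneg_left (hN' n hn m hm).le (formNorm_nonneg (G := G) (q := q) (φ n))
    rw [form_sub_right, G.form_eq_inner q (φ n) (φ m)] at h2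
    rw [hq.sq_formNorm]
    linarith
  have h2 : Tendsto (fun m => G.formNorm q (φ n) * (ε / 2) +
      inner ℝ (G.opEll q (φ n)) (ellTwoIncl X (φ m))) atTop
      (𝓝 (G.formNorm q (φ n) * (ε / 2) + inner ℝ (G.opEll q (φ n)) 0)) :=
    (tendsto_const_nhds.inner hφ.1).const_add _
  have h3 := ge_of_tendsto h2 h1
  rw [inner_zero_right, add_zero, sq] at h3
  have h4 := formNorm_nonneg (q := q) (G := G) (φ n)
  nlinarith

/-- Polarisation reduces existence of the limit to convergence of the seminorm along `φ ± ψ`;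
closability shows that the chosen representatives in `closedForm` give the same limit. -/
theorem FormNonneg.tendsto_closedForm (hq : G.FormNonneg q) {φ ψ : ℕ → X →₀ ℝ} {f g : EllTwo X}
    (hφ : G.IsFormApprox q φ f) (hψ : G.IsFormApprox q ψ g) :
    Tendsto (fun n => G.form q (φ n) (ψ n)) atTop (𝓝 (G.closedForm q f g)) := by
  have hconv : ∀ {φ ψ : ℕ → X →₀ ℝ} {f g : EllTwo X}, G.IsFormApprox q φ f →
      G.IsFormApprox q ψ g → ∃ L, Tendsto (fun n => G.form q (φ n) (ψ n)) atTop (𝓝 L) := by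
    intro φ ψ f g hφ hψ
    obtain ⟨L, hL⟩ := hq.exists_tendsto_formNorm (hq.isFormApprox_add hφ hψ)
    obtain ⟨M, hM⟩ := hq.exists_tendsto_formNorm (hq.isFormApprox_sub hφ hψ)
    refine ⟨(L ^ 2 - M ^ 2) / 4, (((hL.pow 2).sub (hM.pow 2)).div_const 4).congr fun n => ?_⟩
    rw [hq.sq_formNorm, hq.sq_formNorm]
    simp only [form_add_left, form_add_right, form_sub_left, form_sub_right]
    rw [G.form_comm q (ψ n) (φ n)]
    ring
  have hfg : f ∈ G.formDomain q ∧ g ∈ G.formDomain q := ⟨⟨φ, hφ⟩, ⟨ψ, hψ⟩⟩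
  rw [closedForm, dif_pos hfg]
  have hφ' := hfg.1.choose_spec
  have hψ' := hfg.2.choose_spec
  set φ' := hfg.1.choose
  set ψ' := hfg.2.choose
  have hlim := tendsto_nhds_limUnder (hconv hφ' hψ')
  have hdφ := hq.tendsto_formNorm_zero (by simpa using hq.isFormApprox_sub hφ hφ')
  have hdψ := hq.tendsto_formNorm_zero (by simpa using hq.isFormApprox_sub hψ hψ')
  obtain ⟨L, hL⟩ := hq.exists_tendsto_formNorm hφ'
  obtain ⟨M, hM⟩ := hq.exists_tendsto_formNorm hψ
  have hz : Tendsto (fun n => G.form q (φ n) (ψ n) - G.form q (φ' n) (ψ' n)) atTop (𝓝 0) := by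
    refine squeeze_zero_norm (fun n => ?_) (by simpa using (hdφ.mul hM).add (hL.mul hdψ))
    have : G.form q (φ n) (ψ n) - G.form q (φ' n) (ψ' n) =
        G.form q (φ n - φ' n) (ψ n) + G.form q (φ' n) (ψ n - ψ' n) := by
      rw [form_sub_left, form_sub_right]; ring
    rw [this]
    exact (norm_add_le _ _).trans (add_le_add (hq.abs_form_le _ _) (hq.abs_form_le _ _))
  simpa using hz.add hlim

/-- `C_c(X)` is a form core by construction, so testing against it is enough. For `k` approximated
by `ψ n`, the error `h(φ n, ψ n) - ⟨g, ψ n⟩` is the limit in `m` of `h(φ n - φ m, ψ n)`, and the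
seminorms of `ψ n` are bounded. -/
theorem FormNonneg.isOperatorValue_iff (hq : G.FormNonneg q) {f g : EllTwo X} :
    G.IsOperatorValue q f g ↔ f ∈ G.formDomain q ∧
      ∀ φ : X →₀ ℝ, inner ℝ f (G.opEll q φ) = inner ℝ g (ellTwoIncl X φ) := by
  have key : ∀ {φ : ℕ → X →₀ ℝ}, G.IsFormApprox q φ f → ∀ ψ,
      Tendsto (fun n => G.form q (φ n) ψ) atTop (𝓝 (inner ℝ f (G.opEll q ψ))) := by
    intro φ hφ ψ
    simp only [form_eq_inner']
    exact hφ.1.inner tendsto_const_nhds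
  constructor
  · rintro ⟨⟨φ, hφ⟩, h⟩
    refine ⟨⟨φ, hφ⟩, fun ψ => ?_⟩
    rw [← h _ ⟨_, isFormApprox_const ψ⟩]
    exact tendsto_nhds_unique (key hφ ψ) (hq.tendsto_closedForm hφ (isFormApprox_const ψ))
  · rintro ⟨⟨φ, hφ⟩, h⟩
    refine ⟨⟨φ, hφ⟩, ?_⟩
    rintro k ⟨ψ, hψ⟩
    have h1 := hq.tendsto_closedForm hφ hψ
    have h2 : Tendsto (fun n => inner ℝ g (ellTwoIncl X (ψ n))) atTop (𝓝 (inner ℝ g k)) :=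
      tendsto_const_nhds.inner hψ.1
    refine tendsto_nhds_unique h1 ?_
    obtain ⟨M, hM⟩ := hq.exists_tendsto_formNorm hψ
    obtain ⟨C, hC⟩ := hM.bddAbove_range
    have hC : ∀ n, G.formNorm q (ψ n) ≤ C := fun n => hC ⟨n, rfl⟩
    have hC0 : 0 ≤ C := (formNorm_nonneg _).trans (hC 0)
    have hφ2 := ((isFormApprox_iff hq).1 hφ).2
    have hz : Tendsto (fun n => G.form q (φ n) (ψ n) - inner ℝ g (ellTwoIncl X (ψ n)))
        atTop (𝓝 0) := by
      rw [Metric.tendsto_atTop]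
      intro ε hε
      have hε' : 0 < ε / (2 * (C + 1)) := by positivity
      obtain ⟨N, hN⟩ := eventually_atTop.1 (hφ2.eventually_lt_const hε')
      refine ⟨N.1 + N.2, fun n hn => ?_⟩
      rw [Real.dist_eq, sub_zero, ← h]
      have h3 : Tendsto (fun m => |G.form q (φ n) (ψ n) - G.form q (φ m) (ψ n)|) atTop
          (𝓝 |G.form q (φ n) (ψ n) - inner ℝ f (G.opEll q (ψ n))|) :=
        ((key hφ (ψ n)).const_sub _).abs
      have h4 : |G.form q (φ n) (ψ n) - inner ℝ f (G.opEll q (ψ n))| ≤ ε / 2 := by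
        refine le_of_tendsto h3 ?_
        filter_upwards [eventually_ge_atTop (N.1 + N.2)] with m hm
        rw [← form_sub_left]
        refine (hq.abs_form_le _ _).trans ?_
        have h5 := hN (n, m) ⟨by simp; omega, by simp; omega⟩
        calc _ ≤ ε / (2 * (C + 1)) * (C + 1) :=
              mul_le_mul h5.le ((hC n).trans (by linarith)) (formNorm_nonneg _) hε'.le
          _ = ε / 2 := by field_simp
      linarith
    simpa using hz.add h2

theorem FormNonneg.isOperatorValue_add (hq : G.FormNonneg q) {f g f' g' : EllTwo X}
    (h : G.IsOperatorValue q f g) (h' : G.IsOperatorValue q f' g') :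
    G.IsOperatorValue q (f + f') (g + g') := by
  rw [hq.isOperatorValue_iff] at *
  obtain ⟨⟨φ, hφ⟩, h⟩ := h
  obtain ⟨⟨φ', hφ'⟩, h'⟩ := h'
  exact ⟨⟨_, hq.isFormApprox_add hφ hφ'⟩, fun ψ => by rw [inner_add_left, inner_add_left, h, h']⟩

theorem FormNonneg.isOperatorValue_smul (hq : G.FormNonneg q) {f g : EllTwo X} (a : ℝ)
    (h : G.IsOperatorValue q f g) : G.IsOperatorValue q (a • f) (a • g) := by
  rw [hq.isOperatorValue_iff] at *
  obtain ⟨⟨φ, hφ⟩, h⟩ := h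
  exact ⟨⟨_, isFormApprox_smul a hφ⟩, fun ψ => by
    rw [real_inner_smul_left, real_inner_smul_left, h]⟩

theorem FormNonneg.isOperatorValue_sub (hq : G.FormNonneg q) {f g f' g' : EllTwo X}
    (h : G.IsOperatorValue q f g) (h' : G.IsOperatorValue q f' g') :
    G.IsOperatorValue q (f - f') (g - g') := by
  simpa [sub_eq_add_neg] using hq.isOperatorValue_add h (hq.isOperatorValue_smul (-1) h')

theorem FormNonneg.isOperatorValue_nonneg (hq : G.FormNonneg q) {f g : EllTwo X}
    (h : G.IsOperatorValue q f g) : 0 ≤ inner ℝ g f := by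
  rw [← h.2 f h.1]
  obtain ⟨φ, hφ⟩ := h.1
  exact ge_of_tendsto' (hq.tendsto_closedForm hφ hφ) fun n => hq _

theorem FormNonneg.closedForm_comm (hq : G.FormNonneg q) {f g : EllTwo X}
    (hf : f ∈ G.formDomain q) (hg : g ∈ G.formDomain q) :
    G.closedForm q f g = G.closedForm q g f := by
  obtain ⟨φ, hφ⟩ := hf
  obtain ⟨ψ, hψ⟩ := hg
  refine tendsto_nhds_unique (hq.tendsto_closedForm hφ hψ) ?_
  simp only [G.form_comm q (φ _)]
  exact hq.tendsto_closedForm hψ hφ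

theorem FormNonneg.isOperatorValue_symm (hq : G.FormNonneg q) {f g f' g' : EllTwo X}
    (h : G.IsOperatorValue q f g) (h' : G.IsOperatorValue q f' g') :
    inner ℝ g f' = inner ℝ f g' := by
  rw [← h.2 f' h'.1, real_inner_comm, ← h'.2 f h.1, hq.closedForm_comm h.1 h'.1]

theorem FormNonneg.isOperatorValue_inj (hq : G.FormNonneg q) {α : ℝ} (hα : 0 < α)
    {f u v : EllTwo X} (hu : G.IsOperatorValue q u (f - α • u))
    (hv : G.IsOperatorValue q v (f - α • v)) : u = v := by
  have h := hq.isOperatorValue_nonneg (hq.isOperatorValue_sub hu hv)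
  rw [sub_sub_sub_cancel_left, ← smul_sub, ← neg_sub, smul_neg, inner_neg_left,
    real_inner_smul_left, real_inner_self_eq_norm_sq] at h
  have h2 : ‖u - v‖ ^ 2 ≤ 0 := by nlinarith [sq_nonneg ‖u - v‖]
  have h3 : ‖u - v‖ = 0 := by nlinarith [norm_nonneg (u - v)]
  exact sub_eq_zero.1 (norm_eq_zero.1 h3)

/-! ### Resolvents by minimisation -/

/-- The functional `h(φ) + α ‖φ‖² - 2 ⟨f, φ⟩`, minimised by the resolvent. -/
def resolventFunctional (G : WeightedGraph X) (q : X → ℝ) (α : ℝ) (f : EllTwo X) (φ : X →₀ ℝ) :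
    ℝ :=
  G.form q φ φ + α * ‖ellTwoIncl X φ‖ ^ 2 - 2 * inner ℝ f (ellTwoIncl X φ)

theorem FormNonneg.resolventFunctional_bddBelow (hq : G.FormNonneg q) {α : ℝ} (hα : 0 < α)
    (f : EllTwo X) : BddBelow (Set.range (G.resolventFunctional q α f)) := by
  -- The minimum over real `s` of `α s² - 2 ‖f‖ s`.
  refine ⟨-(‖f‖ ^ 2 / α), ?_⟩
  rintro _ ⟨φ, rfl⟩
  have h1 := real_inner_le_norm f (ellTwoIncl X φ)
  have h2 := hq φ
  have h3 : 0 ≤ (α * ‖ellTwoIncl X φ‖ - ‖f‖) ^ 2 / α := by positivity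
  have h4 : (α * ‖ellTwoIncl X φ‖ - ‖f‖) ^ 2 / α =
      α * ‖ellTwoIncl X φ‖ ^ 2 - 2 * (‖f‖ * ‖ellTwoIncl X φ‖) + ‖f‖ ^ 2 / α := by
    field_simp; ring
  rw [resolventFunctional]
  linarith

/-- The infimum over `C_c(X)` need not be attained. The parallelogram law makes a minimising
sequence Cauchy in the form norm, and the Euler–Lagrange equation holds for its limit. -/
theorem FormNonneg.isFormApprox_of_minimizing (hq : G.FormNonneg q) {α : ℝ} (hα : 0 < α)
    {f : EllTwo X} {φ : ℕ → X →₀ ℝ}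
    (hφ : Tendsto (fun n => G.resolventFunctional q α f (φ n)) atTop
      (𝓝 (⨅ ψ, G.resolventFunctional q α f ψ))) :
    ∃ u, G.IsFormApprox q φ u ∧ G.IsOperatorValue q u (f - α • u) := by
  set J := G.resolventFunctional q α f with hJ
  set m := ⨅ ψ, J ψ
  have hm : ∀ ψ, m ≤ J ψ := ciInf_le (hq.resolventFunctional_bddBelow hα f)
  have hpar : ∀ φ ψ, G.form q (φ - ψ) (φ - ψ) + α * ‖ellTwoIncl X (φ - ψ)‖ ^ 2 ≤
      2 * (J φ - m) + 2 * (J ψ - m) := by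
    intro φ ψ
    -- The midpoint is a competitor for the infimum.
    have h1 := hm ((1 / 2 : ℝ) • (φ + ψ))
    simp only [hJ, resolventFunctional, map_smul, map_add, map_sub, form_smul_left,
      form_smul_right, form_add_left, form_add_right, form_sub_left, form_sub_right, norm_smul,
      mul_pow, inner_smul_right, inner_add_right, norm_add_sq_real, norm_sub_sq_real,
      G.form_comm q ψ φ, Real.norm_eq_abs, sq_abs] at h1 ⊢
    linarith
  have hsum : Tendsto (fun p : ℕ × ℕ => 2 * (J (φ p.1) - m) + 2 * (J (φ p.2) - m)) atTop
      (𝓝 0) := by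
    rw [← prod_atTop_atTop_eq]
    have h0 : Tendsto (fun n => 2 * (J (φ n) - m)) atTop (𝓝 0) := by
      simpa using (hφ.sub_const m).const_mul 2
    simpa using (h0.comp tendsto_fst).add (h0.comp (tendsto_snd (f := (atTop : Filter ℕ))))
  have hform : Tendsto (fun p : ℕ × ℕ => G.form q (φ p.1 - φ p.2) (φ p.1 - φ p.2)) atTop
      (𝓝 0) :=
    squeeze_zero (fun p => hq _) (fun p => le_trans (by
      have : 0 ≤ α * ‖ellTwoIncl X (φ p.1 - φ p.2)‖ ^ 2 := by positivity
      linarith) (hpar _ _)) hsum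
  have hnorm : Tendsto (fun p : ℕ × ℕ => ‖ellTwoIncl X (φ p.1 - φ p.2)‖ ^ 2) atTop (𝓝 0) := by
    have h1 : Tendsto (fun p : ℕ × ℕ => α * ‖ellTwoIncl X (φ p.1 - φ p.2)‖ ^ 2) atTop (𝓝 0) :=
      squeeze_zero (fun p => by positivity)
        (fun p => le_trans (le_add_of_nonneg_left (hq _)) (hpar (φ p.1) (φ p.2))) hsum
    simpa [hα.ne'] using h1.const_mul α⁻¹
  have hcauchy : CauchySeq fun n => ellTwoIncl X (φ n) := by
    rw [cauchySeq_iff_tendsto_dist_atTop_0]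
    have h2 := (Real.continuous_sqrt.tendsto 0).comp hnorm
    simpa [Function.comp_def, dist_eq_norm] using h2
  obtain ⟨u, hu⟩ := cauchySeq_tendsto_of_complete hcauchy
  refine ⟨u, ⟨hu, hform⟩, hq.isOperatorValue_iff.2 ⟨⟨φ, hu, hform⟩, fun ψ => ?_⟩⟩
  have hEL : ∀ n, (inner ℝ (ellTwoIncl X (φ n)) (G.opEll q ψ) +
      α * inner ℝ (ellTwoIncl X (φ n)) (ellTwoIncl X ψ) - inner ℝ f (ellTwoIncl X ψ)) ^ 2 ≤
      (J (φ n) - m) * (G.form q ψ ψ + α * ‖ellTwoIncl X ψ‖ ^ 2) := by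
    intro n
    -- A nonnegative quadratic in `t` with constant term `J (φ n) - m → 0`; its discriminant forces
    -- the linear coefficient, the Euler–Lagrange defect, to zero.
    have h1 : ∀ t : ℝ, 0 ≤ (G.form q ψ ψ + α * ‖ellTwoIncl X ψ‖ ^ 2) * (t * t) +
        (2 * (inner ℝ (ellTwoIncl X (φ n)) (G.opEll q ψ) +
          α * inner ℝ (ellTwoIncl X (φ n)) (ellTwoIncl X ψ) - inner ℝ f (ellTwoIncl X ψ))) * t +
        (J (φ n) - m) := by
      intro t
      have h2 := hm (φ n + t • ψ)
      rw [← form_eq_inner']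
      simp only [hJ, resolventFunctional, map_smul, map_add, form_smul_left,
        form_smul_right, form_add_left, form_add_right, norm_smul,
        mul_pow, inner_smul_right, inner_add_right, norm_add_sq_real,
        G.form_comm q ψ (φ n), Real.norm_eq_abs, sq_abs] at h2 ⊢
      linarith
    have h3 := discrim_le_zero h1
    rw [discrim] at h3
    linarith
  have hlim1 : Tendsto (fun n => (inner ℝ (ellTwoIncl X (φ n)) (G.opEll q ψ) +
      α * inner ℝ (ellTwoIncl X (φ n)) (ellTwoIncl X ψ) - inner ℝ f (ellTwoIncl X ψ)) ^ 2) atTop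
      (𝓝 ((inner ℝ u (G.opEll q ψ) +
      α * inner ℝ u (ellTwoIncl X ψ) - inner ℝ f (ellTwoIncl X ψ)) ^ 2)) :=
    (((hu.inner tendsto_const_nhds).add ((hu.inner tendsto_const_nhds).const_mul α)).sub_const
      _).pow 2
  have hlim2 := squeeze_zero (fun n => sq_nonneg _) hEL
    (by simpa using (hφ.sub_const m).mul_const (G.form q ψ ψ + α * ‖ellTwoIncl X ψ‖ ^ 2))
  have h0 := pow_eq_zero_iff (two_ne_zero) |>.1 (tendsto_nhds_unique hlim1 hlim2)
  rw [inner_sub_left, real_inner_smul_left]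
  linarith

theorem FormNonneg.exists_minimizing (hq : G.FormNonneg q) {α : ℝ} (hα : 0 < α) (f : EllTwo X) :
    ∃ φ : ℕ → X →₀ ℝ, Tendsto (fun n => G.resolventFunctional q α f (φ n)) atTop
      (𝓝 (⨅ ψ, G.resolventFunctional q α f ψ)) := by
  obtain ⟨s, -, hs, hs'⟩ := exists_seq_tendsto_sInf (Set.range_nonempty _)
    (hq.resolventFunctional_bddBelow hα f)
  choose φ hφ using hs'
  exact ⟨φ, by simp only [hφ]; exact hs⟩

theorem FormNonneg.exists_isOperatorValue (hq : G.FormNonneg q) {α : ℝ} (hα : 0 < α)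
    (f : EllTwo X) : ∃ u, G.IsOperatorValue q u (f - α • u) := by
  obtain ⟨φ, hφ⟩ := hq.exists_minimizing hα f
  obtain ⟨u, -, hu⟩ := hq.isFormApprox_of_minimizing hα hφ
  exact ⟨u, hu⟩

theorem tendsto_ellTwo_apply {ι : Type*} {l : Filter ι} {f : ι → EllTwo X} {g : EllTwo X}
    (h : Tendsto f l (𝓝 g)) (x : X) : Tendsto (fun i => f i x) l (𝓝 (g x)) := by
  have h1 : ∀ f : EllTwo X, f x = inner ℝ f (ellTwoIncl X (Finsupp.single x 1)) := fun f => by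
    rw [inner_ellTwoIncl_single, mul_one]
  simp only [h1 (f _), h1 g]
  exact h.inner tendsto_const_nhds

/-- Resolvents are positivity preserving. -/
theorem FormNonneg.isOperatorValue_pos (hq : G.FormNonneg q) {α : ℝ} (hα : 0 < α)
    {f u : EllTwo X} (hf : ∀ x, 0 ≤ f x) (hu : G.IsOperatorValue q u (f - α • u)) (x : X) :
    0 ≤ u x := by
  obtain ⟨φ, hφ⟩ := hq.exists_minimizing hα f
  -- As `f ≥ 0`, passing to `|φ|` does not raise the functional. So `|φ n|` is again minimising, and
  -- uniqueness identifies its nonnegative limit with `u`.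
  have hle : ∀ φ, G.resolventFunctional q α f (absFinsupp φ) ≤ G.resolventFunctional q α f φ := by
    intro φ
    have h1 := G.form_absFinsupp_le q φ
    have h2 : ‖ellTwoIncl X (absFinsupp φ)‖ = ‖ellTwoIncl X φ‖ := by
      rw [lp.norm_eq_tsum_rpow (by norm_num), lp.norm_eq_tsum_rpow (by norm_num)]
      simp
    have h3 : inner ℝ f (ellTwoIncl X φ) ≤ inner ℝ f (ellTwoIncl X (absFinsupp φ)) := by
      have hs : ∀ ψ, inner ℝ f (ellTwoIncl X ψ) = ∑' x, f x * ψ x := fun ψ => by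
        rw [tsum_mul_finsupp, inner_ellTwoIncl]
      have hss : ∀ ψ : X →₀ ℝ, Summable fun x => f x * ψ x := fun ψ =>
        (lp.summable_inner (𝕜 := ℝ) f (ellTwoIncl X ψ)).congr fun x => by simp [mul_comm]
      rw [hs, hs]
      exact (hss _).tsum_le_tsum (fun x => mul_le_mul_of_nonneg_left (le_abs_self _) (hf x)) (hss _)
    rw [resolventFunctional, resolventFunctional, h2]
    linarith
  have hφ' : Tendsto (fun n => G.resolventFunctional q α f (absFinsupp (φ n))) atTop
      (𝓝 (⨅ ψ, G.resolventFunctional q α f ψ)) :=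
    tendsto_of_tendsto_of_tendsto_of_le_of_le tendsto_const_nhds hφ
      (fun n => ciInf_le (hq.resolventFunctional_bddBelow hα f) _) (fun n => hle _)
  obtain ⟨v, hv, hv'⟩ := hq.isFormApprox_of_minimizing hα hφ'
  rw [hq.isOperatorValue_inj hα hu hv']
  exact ge_of_tendsto' (tendsto_ellTwo_apply hv.1 x) fun n => abs_nonneg _

end WeightedGraph

/-! ### Contraction semigroups in Hilbert space (Hille–Yosida) -/

section HilleYosida

open Set NormedSpace

variable {E : Type*} [NormedAddCommGroup E] [InnerProductSpace ℝ E]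

/-- A dissipative curve has nonincreasing norm. -/
theorem norm_le_norm_zero_of_dissipative {w w' : ℝ → E} (hw : ContinuousOn w (Ici 0))
    (hw' : ∀ t, 0 ≤ t → HasDerivWithinAt w (w' t) (Ici t) t)
    (hd : ∀ t, 0 ≤ t → inner ℝ (w t) (w' t) ≤ 0) {t : ℝ} (ht : 0 ≤ t) : ‖w t‖ ≤ ‖w 0‖ := by
  have h := image_le_of_deriv_right_le_deriv_boundary (f := fun s => ‖w s‖ ^ 2)
    (f' := fun s => 2 * inner ℝ (w s) (w' s)) (a := 0) (b := t) (B := fun _ => ‖w 0‖ ^ 2)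
    (B' := fun _ => 0)
    ((hw.mono Icc_subset_Ici_self).norm.pow 2) (fun s hs => (hw' s hs.1).norm_sq) le_rfl
    continuousOn_const (fun s _ => hasDerivWithinAt_const _ _ _)
    (fun s hs => by have := hd s hs.1; linarith) (right_mem_Icc.2 ht)
  exact (sq_le_sq₀ (norm_nonneg _) (norm_nonneg _)).1 h

section Bounded

variable [CompleteSpace E]

theorem exp_add_smul_clm {B C : E →L[ℝ] E} (h : Commute B C) :
    exp (B + C) = exp B * exp C :=
  exp_add_of_commute_of_mem_ball (𝕂 := ℝ) h
    ((expSeries_radius_eq_top ℝ (E →L[ℝ] E)).symm ▸ edist_lt_top _ _)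
    ((expSeries_radius_eq_top ℝ (E →L[ℝ] E)).symm ▸ edist_lt_top _ _)

theorem hasDerivAt_exp_smul_apply (B : E →L[ℝ] E) (f : E) (t : ℝ) :
    HasDerivAt (fun s : ℝ => exp (s • B) f) (exp (t • B) (B f)) t := by
  have h := (hasDerivAt_exp_smul_const (𝕂 := ℝ) B t).clm_apply (hasDerivAt_const t f)
  simpa using h

theorem hasDerivAt_exp_smul_apply' (B : E →L[ℝ] E) (f : E) (t : ℝ) :
    HasDerivAt (fun s : ℝ => exp (s • B) f) (B (exp (t • B) f)) t := by
  have h := (hasDerivAt_exp_smul_const' (𝕂 := ℝ) B t).clm_apply (hasDerivAt_const t f)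
  simpa using h

theorem norm_exp_smul_apply_le {B : E →L[ℝ] E} (hB : ∀ f, inner ℝ f (B f) ≤ 0) {t : ℝ}
    (ht : 0 ≤ t) (f : E) : ‖exp (t • B) f‖ ≤ ‖f‖ := by
  have h := norm_le_norm_zero_of_dissipative (w := fun s : ℝ => exp (s • B) f)
    (fun s _ => (hasDerivAt_exp_smul_apply' B f s).continuousAt.continuousWithinAt)
    (fun s _ => (hasDerivAt_exp_smul_apply' B f s).hasDerivWithinAt) (fun s _ => hB _) ht
  simpa using h

/-- The path `s ↦ e^{sB} e^{(t-s)C} f` joins `e^{tC} f` to `e^{tB} f` with velocity `e^{sB}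
e^{(t-s)C} (B - C) f`. -/
theorem norm_exp_smul_apply_sub_le {B C : E →L[ℝ] E} (hB : ∀ f, inner ℝ f (B f) ≤ 0)
    (hC : ∀ f, inner ℝ f (C f) ≤ 0) (hBC : Commute B C) {t : ℝ} (ht : 0 ≤ t) (f : E) :
    ‖exp (t • B) f - exp (t • C) f‖ ≤ ‖B f - C f‖ * t := by
  have hd : ∀ s : ℝ, HasDerivAt (fun s : ℝ => exp (s • B) (exp ((t - s) • C) f))
      (exp (s • B) (exp ((t - s) • C) (B f - C f))) s := by
    intro s
    have h1 : HasDerivAt (fun s : ℝ => exp ((t - s) • C) f) (-(exp ((t - s) • C) (C f))) s := by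
      simpa [Function.comp_def] using
        (hasDerivAt_exp_smul_apply C f (t - s)).scomp s ((hasDerivAt_id s).const_sub t)
    have h2 := (hasDerivAt_exp_smul_const (𝕂 := ℝ) B s).clm_apply h1
    convert h2 using 1
    have hc : Commute B (exp ((t - s) • C)) := (hBC.smul_right _).exp_right
    have hc' := congrArg (fun S : E →L[ℝ] E => S f) hc.eq
    simp only [mul_apply_eq_comp] at hc' ⊢
    rw [hc', map_sub, map_sub, map_neg, sub_eq_add_neg]
  have h := norm_image_sub_le_of_norm_deriv_le_segment' (a := 0) (b := t)
    (fun s _ => (hd s).hasDerivWithinAt) (C := ‖B f - C f‖)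
    (fun s hs => (norm_exp_smul_apply_le hB hs.1 _).trans
      (norm_exp_smul_apply_le hC (by linarith [hs.2]) _)) t (right_mem_Icc.2 ht)
  simpa using h

/-- The exponential of an operator that leaves a closed convex cone invariant does so, too. -/
theorem exp_apply_mem_of_cone {K : Set E} (hK : IsClosed K) (h0 : (0 : E) ∈ K)
    (hadd : ∀ f ∈ K, ∀ g ∈ K, f + g ∈ K) (hsmul : ∀ a : ℝ, 0 ≤ a → ∀ f ∈ K, a • f ∈ K)
    {B : E →L[ℝ] E} (hB : ∀ f ∈ K, B f ∈ K) {f : E} (hf : f ∈ K) : exp B f ∈ K := by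
  have h := (exp_series_hasSum_exp' (𝕂 := ℝ) B).mapL (ContinuousLinearMap.apply ℝ E f)
  refine hK.mem_of_tendsto h (Eventually.of_forall fun s => ?_)
  refine Finset.sum_induction _ (· ∈ K) (fun f g hf hg => hadd f hf g hg) h0 fun n _ => ?_
  simp only [map_smul, ContinuousLinearMap.apply_apply]
  refine hsmul _ (by positivity) _ ?_
  clear * - hB hf
  induction n with
  | zero => simpa using hf
  | succ n ih => rw [pow_succ']; exact hB _ ih

end Bounded

/-- An accretive, densely defined relation with full range condition: the graph of the negative
generator of a contraction semigroup. -/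
structure IsMAccretive (A : E → E → Prop) : Prop where
  add : ∀ {f g f' g'}, A f g → A f' g' → A (f + f') (g + g')
  smul : ∀ (a : ℝ) {f g}, A f g → A (a • f) (a • g)
  nonneg : ∀ {f g}, A f g → 0 ≤ inner ℝ g f
  range : ∀ {α : ℝ}, 0 < α → ∀ f, ∃ u, A u (f - α • u)
  dense : Dense {f | ∃ g, A f g}

/-- `T` is a strongly continuous semigroup on `[0, ∞)` whose negative generator is `A`. -/
structure IsContSemigroup (A : E → E → Prop) (T : ℝ → E →L[ℝ] E) : Prop where
  zero : T 0 = ContinuousLinearMap.id ℝ E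
  add : ∀ s t, 0 ≤ s → 0 ≤ t → T (s + t) = (T s).comp (T t)
  continuousOn : ∀ f, ContinuousOn (fun t => T t f) (Ici 0)
  generator : ∀ f g, HasDerivWithinAt (fun t => T t f) (-g) (Ici 0) 0 ↔ A f g

namespace IsMAccretive

variable {A : E → E → Prop} (hA : IsMAccretive A)
include hA

theorem sub {f g f' g' : E} (h : A f g) (h' : A f' g') : A (f - f') (g - g') := by
  simpa [sub_eq_add_neg] using hA.add h (hA.smul (-1) h')

theorem norm_le {α : ℝ} {f u : E} (h : A u (f - α • u)) : α * ‖u‖ ≤ ‖f‖ := by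
  have h1 := hA.nonneg h
  rw [inner_sub_left, real_inner_smul_left, real_inner_self_eq_norm_sq] at h1
  have h2 := real_inner_le_norm f u
  rcases (norm_nonneg u).eq_or_lt with h0 | h0
  · rw [← h0, mul_zero]; exact norm_nonneg f
  · refine le_of_mul_le_mul_right ?_ h0
    linarith

theorem inj {α : ℝ} (hα : 0 < α) {f u v : E} (hu : A u (f - α • u)) (hv : A v (f - α • v)) :
    u = v := by
  have h := hA.norm_le (f := 0) (α := α) (u := u - v) (by
    convert hA.sub hu hv using 1
    rw [smul_sub]; abel)
  rw [norm_zero] at h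
  have h2 : ‖u - v‖ = 0 := le_antisymm (by nlinarith [norm_nonneg (u - v)]) (norm_nonneg _)
  exact sub_eq_zero.1 (norm_eq_zero.1 h2)

end IsMAccretive

namespace IsMAccretive

variable {A : E → E → Prop} (hA : IsMAccretive A)

/-- The resolvent `(A + α)⁻¹`. -/
def res {α : ℝ} (hα : 0 < α) : E →L[ℝ] E :=
  LinearMap.mkContinuous
    { toFun := fun f => (hA.range hα f).choose
      map_add' := fun f g => hA.inj hα (hA.range hα _).choose_spec (by
        convert hA.add (hA.range hα f).choose_spec (hA.range hα g).choose_spec using 1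
        rw [smul_add]; abel)
      map_smul' := fun a f => hA.inj hα (hA.range hα _).choose_spec (by
        have h := hA.smul a (hA.range hα f).choose_spec
        rw [smul_sub, smul_comm a α] at h
        exact h) }
    α⁻¹ fun f => by
      rw [inv_mul_eq_div, le_div_iff₀' hα]
      exact hA.norm_le (hA.range hα f).choose_spec

theorem res_spec {α : ℝ} (hα : 0 < α) (f : E) :
    A (hA.res hα f) (f - α • hA.res hα f) := (hA.range hα f).choose_spec

theorem res_eq {α : ℝ} (hα : 0 < α) {f g : E} (h : A f g) :
    hA.res hα (g + α • f) = f :=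
  hA.inj hα (hA.res_spec hα _) (by simpa using h)

theorem res_commute {α β : ℝ} (hα : 0 < α) (hβ : 0 < β) : Commute (hA.res hα) (hA.res hβ) := by
  -- The first resolvent identity; exchanging `α` and `β` and cancelling `β - α` gives commutation.
  have key : ∀ {α β : ℝ} (hα : 0 < α) (hβ : 0 < β) (f : E),
      hA.res hα f - hA.res hβ f = (β - α) • hA.res hα (hA.res hβ f) := by
    intro α β hα hβ f
    have h := hA.sub (hA.res_spec hα f) (hA.res_spec hβ f)
    have h2 := hA.res_eq hα h
    rw [← map_smul]
    refine h2.symm.trans (congrArg _ ?_)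
    module
  refine ContinuousLinearMap.ext fun f => ?_
  rcases eq_or_ne α β with rfl | hne
  · rfl
  · have h1 := key hα hβ f
    have h2 := key hβ hα f
    rw [← neg_sub, h1, ← smul_neg, ← neg_smul_neg, neg_neg] at h2
    simpa [sub_ne_zero.2 hne, sub_ne_zero.2 hne.symm] using h2

/-- The Yosida approximation of `-A`. -/
def yosida {α : ℝ} (hα : 0 < α) : E →L[ℝ] E := (α ^ 2) • hA.res hα - α • 1

theorem yosida_apply {α : ℝ} (hα : 0 < α) (f : E) :
    hA.yosida hα f = α ^ 2 • hA.res hα f - α • f := rfl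

theorem yosida_commute {α β : ℝ} (hα : 0 < α) (hβ : 0 < β) :
    Commute (hA.yosida hα) (hA.yosida hβ) := by
  have h := hA.res_commute hα hβ
  refine Commute.sub_left (Commute.sub_right ?_ ?_) (Commute.sub_right ?_ ?_)
  · exact (h.smul_left _).smul_right _
  · exact (Commute.one_right _).smul_right _
  · exact (Commute.one_left _).smul_left _
  · exact (Commute.one_left _).smul_left _

theorem norm_res_le {α : ℝ} (hα : 0 < α) (f : E) : ‖α • hA.res hα f‖ ≤ ‖f‖ := by
  rw [norm_smul, Real.norm_of_nonneg hα.le]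
  exact hA.norm_le (hA.res_spec hα f)

theorem yosida_dissipative {α : ℝ} (hα : 0 < α) (f : E) : inner ℝ f (hA.yosida hα f) ≤ 0 := by
  have h1 := real_inner_le_norm f (α • hA.res hα f)
  have h2 := hA.norm_res_le hα f
  have h3 : hA.yosida hα f = α • (α • hA.res hα f - f) := by rw [yosida_apply]; module
  rw [h3, real_inner_smul_right, inner_sub_right, real_inner_self_eq_norm_sq]
  refine mul_nonpos_of_nonneg_of_nonpos hα.le ?_
  nlinarith [norm_nonneg f]

/-- On the domain the approximation is `-α (A + α)⁻¹` applied to `g = A f`, hence bounded by `‖g‖`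
and convergent to `-g` once `α (A + α)⁻¹ → 1`. -/
theorem yosida_eq {α : ℝ} (hα : 0 < α) {f g : E} (h : A f g) :
    hA.yosida hα f = -(α • hA.res hα g) := by
  have h1 := hA.res_eq hα h
  rw [map_add, map_smul] at h1
  rw [yosida_apply]
  nth_rw 2 [← h1]
  module

theorem norm_yosida_le {α : ℝ} (hα : 0 < α) {f g : E} (h : A f g) :
    ‖hA.yosida hα f‖ ≤ ‖g‖ := by
  rw [hA.yosida_eq hα h, norm_neg]
  exact hA.norm_res_le hα g

end IsMAccretive

/-- Pointwise convergence of contractions on a dense set extends to the whole space. -/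
theorem cauchySeq_of_dense_of_contraction {S : ℕ → E →L[ℝ] E} (hS : ∀ n f, ‖S n f‖ ≤ ‖f‖)
    {D : Set E} (hD : Dense D) (h : ∀ f ∈ D, CauchySeq fun n => S n f) (f : E) :
    CauchySeq fun n => S n f := by
  rw [Metric.cauchySeq_iff]
  intro ε hε
  obtain ⟨g, hg, hfg⟩ := Metric.dense_iff.1 hD f (ε / 3) (by positivity)
  rw [Metric.mem_ball, dist_eq_norm, norm_sub_rev] at hg
  obtain ⟨N, hN⟩ := Metric.cauchySeq_iff.1 (h g hfg) (ε / 3) (by positivity)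
  refine ⟨N, fun m hm n hn => ?_⟩
  have h1 := hS m (f - g)
  have h2 := hS n (f - g)
  have h3 := hN m hm n hn
  rw [map_sub] at h1 h2
  rw [dist_eq_norm] at h3 ⊢
  have h4 : S m f - S n f = (S m f - S m g) + (S m g - S n g) - (S n f - S n g) := by abel
  rw [h4]
  have h5 := norm_sub_le (S m f - S m g + (S m g - S n g)) (S n f - S n g)
  have h6 := norm_add_le (S m f - S m g) (S m g - S n g)
  linarith

theorem tendsto_of_dense_of_contraction {S : ℕ → E →L[ℝ] E} (hS : ∀ n f, ‖S n f‖ ≤ ‖f‖)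
    {D : Set E} (hD : Dense D) (h : ∀ f ∈ D, Tendsto (fun n => S n f) atTop (𝓝 f)) (f : E) :
    Tendsto (fun n => S n f) atTop (𝓝 f) := by
  rw [Metric.tendsto_atTop]
  intro ε hε
  obtain ⟨g, hg, hfg⟩ := Metric.dense_iff.1 hD f (ε / 3) (by positivity)
  rw [Metric.mem_ball, dist_eq_norm, norm_sub_rev] at hg
  obtain ⟨N, hN⟩ := Metric.tendsto_atTop.1 (h g hfg) (ε / 3) (by positivity)
  refine ⟨N, fun n hn => ?_⟩
  have h1 := hS n (f - g)
  have h3 := hN n hn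
  rw [map_sub] at h1
  rw [dist_eq_norm] at h3 ⊢
  have h4 : S n f - f = (S n f - S n g) + (S n g - g) - (f - g) := by abel
  rw [h4]
  have h5 := norm_sub_le (S n f - S n g + (S n g - g)) (f - g)
  have h6 := norm_add_le (S n f - S n g) (S n g - g)
  linarith

/-- A contraction-valued function is strongly continuous if it is so on a dense set. -/
theorem continuous_of_dense_of_contraction {T : ℝ → E →L[ℝ] E} (hT : ∀ t f, ‖T t f‖ ≤ ‖f‖)
    {D : Set E} (hD : Dense D) (h : ∀ f ∈ D, Continuous fun t => T t f) (f : E) :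
    Continuous fun t => T t f := by
  rw [Metric.continuous_iff']
  intro t ε hε
  obtain ⟨g, hg, hfg⟩ := Metric.dense_iff.1 hD f (ε / 3) (by positivity)
  rw [Metric.mem_ball, dist_eq_norm, norm_sub_rev] at hg
  filter_upwards [Metric.continuous_iff'.1 (h g hfg) t (ε / 3) (by positivity)] with s hs
  have h1 := hT s (f - g)
  have h2 := hT t (f - g)
  rw [map_sub] at h1 h2
  rw [dist_eq_norm] at hs ⊢
  have h4 : T s f - T t f = (T s f - T s g) + (T s g - T t g) - (T t f - T t g) := by abel
  rw [h4]
  have h5 := norm_sub_le (T s f - T s g + (T s g - T t g)) (T t f - T t g)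
  have h6 := norm_add_le (T s f - T s g) (T s g - T t g)
  linarith

namespace IsMAccretive

variable {A : E → E → Prop} (hA : IsMAccretive A)

/-- The Yosida approximations of `-A` along the positive integers. -/
def yosidaSeq (n : ℕ) : E →L[ℝ] E := hA.yosida (α := (n : ℝ) + 1) (by positivity)

theorem tendsto_yosidaSeq {f g : E} (h : A f g) :
    Tendsto (fun n => hA.yosidaSeq n f) atTop (𝓝 (-g)) := by
  have hpos : ∀ n : ℕ, (0 : ℝ) < (n : ℝ) + 1 := fun n => by positivity
  -- Strong convergence `α (A + α)⁻¹ → 1`: on the domain the error is `-(A + α)⁻¹ k`, of norm at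
  -- most `‖k‖ / α`.
  have key := tendsto_of_dense_of_contraction
    (S := fun n : ℕ => ((n : ℝ) + 1) • hA.res (hpos n)) (fun n f => hA.norm_res_le (hpos n) f)
    hA.dense (by
      rintro f ⟨k, hk⟩
      rw [tendsto_iff_norm_sub_tendsto_zero]
      have hlim : Tendsto (fun n : ℕ => ‖k‖ * (1 / ((n : ℝ) + 1))) atTop (𝓝 0) := by
        simpa using tendsto_one_div_add_atTop_nhds_zero_nat.const_mul ‖k‖
      refine squeeze_zero (fun _ => norm_nonneg _) (fun n => ?_) hlim
      have h1 := hA.res_eq (hpos n) hk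
      rw [map_add, map_smul] at h1
      have h2 : (((n : ℝ) + 1) • hA.res (hpos n)) f - f = -(hA.res (hpos n) k) := by
        nth_rw 2 [← h1]
        rw [smul_apply]
        abel
      rw [h2, norm_neg, mul_one_div, le_div_iff₀' (hpos n)]
      exact hA.norm_le (hA.res_spec (hpos n) k)) g
  refine key.neg.congr fun n => ?_
  exact (hA.yosida_eq (hpos n) h).symm

variable [CompleteSpace E]

theorem norm_exp_yosidaSeq_le (n : ℕ) {t : ℝ} (ht : 0 ≤ t) (f : E) :
    ‖exp (t • hA.yosidaSeq n) f‖ ≤ ‖f‖ :=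
  norm_exp_smul_apply_le (hA.yosida_dissipative _) ht f

theorem cauchySeq_exp_yosidaSeq {t : ℝ} (ht : 0 ≤ t) (f : E) :
    CauchySeq fun n => exp (t • hA.yosidaSeq n) f := by
  refine cauchySeq_of_dense_of_contraction (S := fun n => exp (t • hA.yosidaSeq n))
    (fun n f => hA.norm_exp_yosidaSeq_le n ht f) hA.dense ?_ f
  rintro f ⟨g, hfg⟩
  rw [cauchySeq_iff_tendsto_dist_atTop_0]
  have h := cauchySeq_iff_tendsto_dist_atTop_0.1 (hA.tendsto_yosidaSeq hfg).cauchySeq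
  refine squeeze_zero (fun _ => dist_nonneg) (fun p => ?_) (by simpa using h.mul_const t)
  rw [dist_eq_norm, dist_eq_norm]
  exact norm_exp_smul_apply_sub_le (hA.yosida_dissipative _) (hA.yosida_dissipative _)
    (hA.yosida_commute _ _) ht f

/-- The Hille–Yosida theorem for accretive operators in Hilbert spaces, with the semigroup as the
limit of the exponentials of the Yosida approximations. -/
theorem exists_semigroup : ∃ T : ℝ → E →L[ℝ] E, IsContSemigroup A T ∧
    ∀ t, 0 ≤ t → ∀ f, Tendsto (fun n => exp (t • hA.yosidaSeq n) f) atTop (𝓝 (T t f)) := by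
  -- Freezing negative times at `max t 0` makes `T` contractive and strongly continuous on the whole
  -- line.
  choose L hL using fun (t : ℝ) (f : E) => cauchySeq_tendsto_of_complete
    (hA.cauchySeq_exp_yosidaSeq (le_max_right t 0) f)
  let T : ℝ → E →L[ℝ] E := fun t =>
    continuousLinearMapOfTendsto (fun n => exp (max t 0 • hA.yosidaSeq n)) (f := L t)
      (tendsto_pi_nhds.2 (hL t))
  have hT : ∀ t f, Tendsto (fun n => exp (max t 0 • hA.yosidaSeq n) f) atTop (𝓝 (T t f)) := hL
  have hT' : ∀ t, 0 ≤ t → ∀ f, Tendsto (fun n => exp (t • hA.yosidaSeq n) f) atTop (𝓝 (T t f)) :=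
    fun t ht f => by simpa only [max_eq_left ht] using hT t f
  clear_value T
  have hcontr : ∀ t f, ‖T t f‖ ≤ ‖f‖ := fun t f =>
    le_of_tendsto' (hT t f).norm fun n => hA.norm_exp_yosidaSeq_le n (le_max_right t 0) f
  have hzero : T 0 = ContinuousLinearMap.id ℝ E := by
    refine ContinuousLinearMap.ext fun f => ?_
    have h := hT' 0 le_rfl f
    simp only [zero_smul, exp_zero] at h
    exact tendsto_nhds_unique h tendsto_const_nhds
  have hcont : ∀ f, Continuous fun t => T t f := by
    refine continuous_of_dense_of_contraction hcontr hA.dense ?_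
    rintro f ⟨g, hfg⟩
    refine (LipschitzWith.of_dist_le_mul (K := ‖g‖₊) fun s t => ?_).continuous
    rw [dist_eq_norm, dist_eq_norm]
    refine le_of_tendsto' ((hT s f).sub (hT t f)).norm fun n => ?_
    have h := (convex_Ici (0 : ℝ)).norm_image_sub_le_of_norm_hasDerivWithin_le
      (f := fun s : ℝ => exp (s • hA.yosidaSeq n) f) (C := ‖g‖)
      (fun s _ => (hasDerivAt_exp_smul_apply (hA.yosidaSeq n) f s).hasDerivWithinAt)
      (fun s hs => (hA.norm_exp_yosidaSeq_le n hs _).trans (hA.norm_yosida_le _ hfg))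
      (x := max t 0) (y := max s 0) (mem_Ici.2 (le_max_right _ _)) (mem_Ici.2 (le_max_right _ _))
    refine h.trans (mul_le_mul_of_nonneg_left ?_ (norm_nonneg _))
    rw [Real.norm_eq_abs, Real.norm_eq_abs]
    exact abs_max_sub_max_le_abs s t 0
  -- The integrated evolution equation, by dominated convergence from the Yosida approximations;
  -- differentiating it at 0 gives one half of the generator identity.
  have hint : ∀ {f g}, A f g → ∀ t, 0 ≤ t → ∫ s in (0 : ℝ)..t, T s g = f - T t f := by
    intro f g hfg t ht
    have h1 : ∀ n, ∫ s in (0 : ℝ)..t, exp (s • hA.yosidaSeq n) (hA.yosidaSeq n f) =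
        exp (t • hA.yosidaSeq n) f - f := by
      intro n
      rw [intervalIntegral.integral_eq_sub_of_hasDerivAt
        (fun s _ => hasDerivAt_exp_smul_apply (hA.yosidaSeq n) f s)]
      · simp
      · refine Continuous.intervalIntegrable ?_ _ _
        exact continuous_iff_continuousAt.2 fun s =>
          (hasDerivAt_exp_smul_apply (hA.yosidaSeq n) _ s).continuousAt
    have h2 : Tendsto (fun n => ∫ s in (0 : ℝ)..t,
        exp (s • hA.yosidaSeq n) (hA.yosidaSeq n f)) atTop (𝓝 (∫ s in (0 : ℝ)..t, T s (-g))) := by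
      refine intervalIntegral.tendsto_integral_filter_of_dominated_convergence (fun _ => ‖g‖)
        (Eventually.of_forall fun n => ?_) (Eventually.of_forall fun n => ?_)
        intervalIntegrable_const ?_
      · refine Continuous.aestronglyMeasurable ?_
        exact continuous_iff_continuousAt.2 fun s =>
          (hasDerivAt_exp_smul_apply (hA.yosidaSeq n) _ s).continuousAt
      · refine Eventually.of_forall fun s hs => ?_
        rw [uIoc_of_le ht] at hs
        exact (hA.norm_exp_yosidaSeq_le n hs.1.le _).trans (hA.norm_yosida_le _ hfg)
      · refine Eventually.of_forall fun s hs => ?_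
        rw [uIoc_of_le ht] at hs
        have h3 : Tendsto (fun n => exp (s • hA.yosidaSeq n) (hA.yosidaSeq n f - -g)) atTop
            (𝓝 0) := by
          refine squeeze_zero_norm (fun n => hA.norm_exp_yosidaSeq_le n hs.1.le _) ?_
          simpa using ((hA.tendsto_yosidaSeq hfg).sub_const (-g)).norm
        refine (zero_add (T s (-g)) ▸ h3.add (hT' s hs.1.le (-g))).congr fun n => ?_
        rw [map_sub, sub_add_cancel]
    simp only [h1] at h2
    have h4 := tendsto_nhds_unique h2 ((hT' t ht f).sub_const f)
    simp only [map_neg, intervalIntegral.integral_neg] at h4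
    rw [← neg_sub, ← h4, neg_neg]
  have hgen : ∀ {f g}, A f g → HasDerivWithinAt (fun t => T t f) (-g) (Ici 0) 0 := by
    intro f g hfg
    have h1 : HasDerivAt (fun t => ∫ s in (0 : ℝ)..t, T s g) (T 0 g) 0 :=
      intervalIntegral.integral_hasDerivAt_right ((hcont g).intervalIntegrable _ _)
        ((hcont g).stronglyMeasurableAtFilter _ _) (hcont g).continuousAt
    rw [hzero] at h1
    refine (h1.const_sub f).hasDerivWithinAt.congr (fun t ht => ?_) ?_
    · rw [hint hfg t ht]; abel
    · rw [hint hfg 0 le_rfl]; abel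
  refine ⟨T, ⟨hzero, fun s t hs ht => ?_, fun f => (hcont f).continuousOn, fun f g => ⟨?_, hgen⟩⟩,
    hT'⟩
  · refine ContinuousLinearMap.ext fun f => ?_
    refine tendsto_nhds_unique (hT' (s + t) (add_nonneg hs ht) f) ?_
    have h3 : Tendsto (fun n => exp (s • hA.yosidaSeq n) (exp (t • hA.yosidaSeq n) f - T t f))
        atTop (𝓝 0) := by
      refine squeeze_zero_norm (fun n => hA.norm_exp_yosidaSeq_le n hs _) ?_
      simpa using ((hT' t ht f).sub_const (T t f)).norm
    refine (zero_add (T s (T t f)) ▸ h3.add (hT' s hs (T t f))).congr fun n => ?_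
    rw [map_sub, sub_add_cancel, add_smul,
      exp_add_smul_clm (((Commute.refl _).smul_left _).smul_right _)]
    rfl
  -- The generator cannot be larger than `-A`: with `A u + u = f + g` the orbit of `f - u` has
  -- derivative `f - u` at 0, and such growth contradicts contractivity unless `f = u`.
  · intro hd
    obtain ⟨u, hu⟩ := hA.range one_pos (f + g)
    rw [one_smul] at hu
    have hw := hd.sub (hgen hu)
    have hw' : HasDerivWithinAt (fun t => T t (f - u)) (f - u) (Ici 0) 0 := by
      convert hw using 1
      · ext t; simp
      · abel
    have hz : f - u = 0 := by
      have h1 := hw'.inner (𝕜 := ℝ) (hasDerivWithinAt_const (0 : ℝ) (Ici 0) (f - u))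
      rw [inner_zero_right, zero_add, real_inner_self_eq_norm_sq] at h1
      have h2 := hasDerivWithinAt_iff_tendsto_slope.1 h1
      have h3 : ‖f - u‖ ^ 2 ≤ 0 := by
        have : (𝓝[Ici 0 \ {0}] (0 : ℝ)).NeBot := by
          rw [Ici_sdiff_left]; infer_instance
        refine le_of_tendsto h2 ?_
        filter_upwards [self_mem_nhdsWithin] with t ht
        rw [slope_def_field]
        refine div_nonpos_of_nonpos_of_nonneg ?_ (by simpa using ht.1)
        rw [hzero, ContinuousLinearMap.id_apply, real_inner_self_eq_norm_sq, sub_nonpos, sq]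
        exact (real_inner_le_norm _ _).trans
          (mul_le_mul_of_nonneg_right (hcontr _ _) (norm_nonneg _))
      have h4 : ‖f - u‖ = 0 := by nlinarith [norm_nonneg (f - u)]
      exact norm_eq_zero.1 h4
    rw [← sub_eq_zero.1 hz, add_sub_cancel_left] at hu
    exact hu

/-- The semigroup leaves a closed convex cone invariant if the resolvents do. -/
theorem exp_yosidaSeq_mem_of_cone {K : Set E} (hK : IsClosed K) (h0 : (0 : E) ∈ K)
    (hadd : ∀ f ∈ K, ∀ g ∈ K, f + g ∈ K) (hsmul : ∀ a : ℝ, 0 ≤ a → ∀ f ∈ K, a • f ∈ K)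
    (hres : ∀ α : ℝ, 0 < α → ∀ f ∈ K, ∀ u, A u (f - α • u) → u ∈ K) (n : ℕ) {t : ℝ} (ht : 0 ≤ t)
    {f : E} (hf : f ∈ K) : exp (t • hA.yosidaSeq n) f ∈ K := by
  have hpos : (0 : ℝ) < (n : ℝ) + 1 := by positivity
  set α : ℝ := (n : ℝ) + 1 with hα
  -- The exponential splits into that of a nonnegative multiple of the resolvent, which preserves
  -- the cone, and the positive scalar `e^{-tα}`.
  have h1 : t • hA.yosidaSeq n = (t * α ^ 2) • hA.res hpos +
      algebraMap ℝ (E →L[ℝ] E) (-(t * α)) := by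
    rw [Algebra.algebraMap_eq_smul_one, yosidaSeq, yosida, smul_sub, smul_smul, smul_smul,
      neg_smul, ← sub_eq_add_neg]
  rw [h1, exp_add_smul_clm (Algebra.commute_algebraMap_right _ _), ← algebraMap_exp_comm,
    Algebra.algebraMap_eq_smul_one, mul_smul_comm, mul_one, ← Real.exp_eq_exp_ℝ]
  refine hsmul _ (Real.exp_pos _).le _ (exp_apply_mem_of_cone hK h0 hadd hsmul ?_ hf)
  intro f hf
  exact hsmul _ (by positivity) _ (hres _ hpos f hf _ (hA.res_spec hpos f))

end IsMAccretive

namespace IsContSemigroup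

variable {A : E → E → Prop} {T : ℝ → E →L[ℝ] E}

theorem map_generator (hT : IsContSemigroup A T) {f g : E} (h : A f g) {t : ℝ} (ht : 0 ≤ t) :
    A (T t f) (T t g) := by
  rw [← hT.generator]
  have h1 := (T t).hasFDerivAt.comp_hasDerivWithinAt 0 ((hT.generator f g).2 h)
  rw [map_neg] at h1
  refine h1.congr (fun s hs => ?_) ?_
  · rw [Function.comp_apply, ← ContinuousLinearMap.comp_apply, ← ContinuousLinearMap.comp_apply,
      ← hT.add s t hs ht, ← hT.add t s ht hs, add_comm]
  · simp [hT.zero]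

theorem hasDerivWithinAt (hT : IsContSemigroup A T) {f g : E} (h : A f g) {t : ℝ} (ht : 0 ≤ t) :
    HasDerivWithinAt (fun s => T s f) (-T t g) (Ici t) t := by
  have h1 := (T t).hasFDerivAt.comp_hasDerivWithinAt 0 ((hT.generator f g).2 h)
  rw [map_neg] at h1
  have h3 : HasDerivWithinAt (fun s : ℝ => s - t) 1 (Ici t) t :=
    ((hasDerivAt_id t).sub_const t).hasDerivWithinAt
  have h2 := HasDerivWithinAt.scomp_of_eq (h := fun s => s - t) t h1 h3
    (fun s hs => mem_Ici.2 (sub_nonneg.2 hs)) (sub_self t).symm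
  rw [one_smul] at h2
  refine h2.congr (fun s hs => ?_) ?_
  · rw [Function.comp_apply, Function.comp_apply, ← ContinuousLinearMap.comp_apply,
      ← hT.add t (s - t) ht (sub_nonneg.2 hs), add_sub_cancel]
  · simp [hT.zero]

theorem norm_le (hT : IsContSemigroup A T) (hA : IsMAccretive A) {f g : E} (h : A f g) {t : ℝ}
    (ht : 0 ≤ t) : ‖T t f‖ ≤ ‖f‖ := by
  have h1 := norm_le_norm_zero_of_dissipative (hT.continuousOn f)
    (fun s hs => hT.hasDerivWithinAt h hs) (fun s hs => by
      rw [inner_neg_right, real_inner_comm]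
      exact neg_nonpos.2 (hA.nonneg (hT.map_generator h hs))) ht
  simpa [hT.zero] using h1

/-- The difference of two orbits with the same initial value in the domain is dissipative. A
semigroup obtained by choice thus coincides with the Yosida limit, for which cone invariance is
visible. -/
theorem unique (hA : IsMAccretive A) {S T : ℝ → E →L[ℝ] E} (hS : IsContSemigroup A S)
    (hT : IsContSemigroup A T) {t : ℝ} (ht : 0 ≤ t) : S t = T t := by
  refine ContinuousLinearMap.ext fun f => ?_
  refine congrFun (Continuous.ext_on hA.dense (S t).continuous (T t).continuous ?_) f
  rintro f ⟨g, hfg⟩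
  have h1 := norm_le_norm_zero_of_dissipative ((hS.continuousOn f).sub (hT.continuousOn f))
    (fun s hs => (hS.hasDerivWithinAt hfg hs).sub (hT.hasDerivWithinAt hfg hs)) (fun s hs => by
      rw [← neg_sub', inner_neg_right, real_inner_comm]
      exact neg_nonpos.2 (hA.nonneg (hA.sub (hS.map_generator hfg hs) (hT.map_generator hfg hs))))
    ht
  simpa [hS.zero, hT.zero, sub_eq_zero] using h1

theorem mem_of_cone [CompleteSpace E] (hA : IsMAccretive A) (hT : IsContSemigroup A T)
    {K : Set E} (hK : IsClosed K) (h0 : (0 : E) ∈ K)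
    (hadd : ∀ f ∈ K, ∀ g ∈ K, f + g ∈ K) (hsmul : ∀ a : ℝ, 0 ≤ a → ∀ f ∈ K, a • f ∈ K)
    (hres : ∀ α : ℝ, 0 < α → ∀ f ∈ K, ∀ u, A u (f - α • u) → u ∈ K) {t : ℝ} (ht : 0 ≤ t)
    {f : E} (hf : f ∈ K) : T t f ∈ K := by
  obtain ⟨S, hS, hlim⟩ := hA.exists_semigroup
  rw [hT.unique hA hS ht]
  exact hK.mem_of_tendsto (hlim t ht f) (Eventually.of_forall fun n =>
    hA.exp_yosidaSeq_mem_of_cone hK h0 hadd hsmul hres n ht hf)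

/-- The Laplace transform of the semigroup is the resolvent. -/
theorem integral_exp_smul [CompleteSpace E] (hT : IsContSemigroup A T) {α : ℝ} {f u : E}
    (h : A u (f - α • u)) {t : ℝ} (ht : 0 ≤ t) :
    ∫ s in (0 : ℝ)..t, Real.exp (-(α * s)) • T s f = u - Real.exp (-(α * t)) • T t u := by
  have he : ∀ s : ℝ, HasDerivAt (fun s => Real.exp (-(α * s))) (-(α * Real.exp (-(α * s)))) s := by
    intro s
    have := ((hasDerivAt_id s).const_mul α).neg.exp
    simpa [mul_comm] using this
  have hce : Continuous fun s : ℝ => Real.exp (-(α * s)) := by fun_prop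
  -- Since `A u = f - α u`, the terms in `u` cancel.
  have hd : ∀ s, 0 ≤ s → HasDerivWithinAt (fun s => Real.exp (-(α * s)) • T s u)
      (-(Real.exp (-(α * s)) • T s f)) (Ici s) s := by
    intro s hs
    have h1 := (he s).hasDerivWithinAt.smul (hT.hasDerivWithinAt h hs)
    refine h1.congr_deriv ?_
    rw [map_sub, map_smul]
    module
  have hmono : uIcc 0 t ⊆ Ici 0 := by rw [uIcc_of_le ht]; exact Icc_subset_Ici_self
  have h2 := intervalIntegral.integral_eq_sub_of_hasDeriv_right
    (f := fun s => Real.exp (-(α * s)) • T s u) (f' := fun s => -(Real.exp (-(α * s)) • T s f))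
    (hce.continuousOn.smul ((hT.continuousOn u).mono hmono))
    (fun s hs => (hd s (by rw [min_eq_left ht] at hs; exact hs.1.le)).mono Ioi_subset_Ici_self)
    (hce.continuousOn.smul ((hT.continuousOn f).mono hmono)).neg.intervalIntegrable
  rw [intervalIntegral.integral_neg] at h2
  rw [← neg_inj, h2]
  simp [hT.zero]

end IsContSemigroup

end HilleYosida

/-! ### Realisation of the resolvent and the semigroup of `H⁽¹⁾` -/

theorem dense_range_ellTwoIncl (X : Type*) : Dense (Set.range (ellTwoIncl X)) := by
  rw [← LinearMap.coe_range, Submodule.dense_iff_topologicalClosure_eq_top,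
    Submodule.topologicalClosure_eq_top_iff, Submodule.eq_bot_iff]
  intro f hf
  refine ellTwo_eq_of_inner fun φ => ?_
  rw [inner_zero_left, real_inner_comm]
  exact hf _ ⟨φ, rfl⟩

namespace WeightedGraph

variable {X : Type*} {G : WeightedGraph X} {q : X → ℝ}

theorem FormNonneg.isOperatorValue_ellTwoIncl (hq : G.FormNonneg q) (φ : X →₀ ℝ) :
    G.IsOperatorValue q (ellTwoIncl X φ) (G.opEll q φ) :=
  hq.isOperatorValue_iff.2 ⟨⟨_, isFormApprox_const φ⟩, fun ψ => by
    rw [← form_eq_inner, form_eq_inner']⟩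

theorem FormNonneg.isMAccretive (hq : G.FormNonneg q) : IsMAccretive (G.IsOperatorValue q) where
  add := hq.isOperatorValue_add
  smul a _ _ := hq.isOperatorValue_smul a
  nonneg := hq.isOperatorValue_nonneg
  range := hq.exists_isOperatorValue
  dense := (dense_range_ellTwoIncl X).mono (by
    rintro _ ⟨φ, rfl⟩
    exact ⟨_, hq.isOperatorValue_ellTwoIncl φ⟩)

theorem FormNonneg.resolvent_spec (hq : G.FormNonneg q) {α : ℝ} (hα : 0 < α) (f : EllTwo X) :
    G.IsOperatorValue q (G.resolvent q (-α) f) (f - α • G.resolvent q (-α) f) := by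
  have h : ∃ u, G.IsOperatorValue q u (f + (-α) • u) := by
    simpa [← sub_eq_add_neg] using hq.exists_isOperatorValue hα f
  have h2 := h.choose_spec
  rw [neg_smul, ← sub_eq_add_neg] at h2
  rw [resolvent, dif_pos h]
  exact h2

theorem FormNonneg.isHeatSemigroup (hq : G.FormNonneg q) :
    IsContSemigroup (G.IsOperatorValue q) (G.heatSemigroup q) := by
  have h : ∃ T, G.IsHeatSemigroup q T := by
    obtain ⟨T, hT, -⟩ := hq.isMAccretive.exists_semigroup
    exact ⟨T, hT.zero, hT.add, hT.continuousOn, hT.generator⟩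
  have hT := h.choose_spec
  rw [heatSemigroup, dif_pos h]
  exact ⟨hT.zero, hT.add, hT.continuousOn, hT.generator⟩

/-- The characteristic function of `{x}` in `ℓ²(X)`. -/
def ellTwoSingle (x : X) : EllTwo X := ellTwoIncl X (Finsupp.single x 1)

theorem inner_ellTwoSingle (f : EllTwo X) (x : X) : inner ℝ f (ellTwoSingle x) = f x := by
  rw [ellTwoSingle, inner_ellTwoIncl_single, mul_one]

theorem inner_ellTwoSingle_left (f : EllTwo X) (x : X) : inner ℝ (ellTwoSingle x) f = f x := by
  rw [real_inner_comm, inner_ellTwoSingle]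

theorem ellTwoSingle_nonneg (x y : X) : 0 ≤ ellTwoSingle x y := by
  classical
  rw [ellTwoSingle, ellTwoIncl_apply, Finsupp.single_apply]
  split_ifs <;> norm_num

/-! ### Green functions and point bounds -/

/-- The Green function `(H⁽¹⁾ + α)⁻¹ 1_{x} (y)`. -/
def green (G : WeightedGraph X) (q : X → ℝ) (α : ℝ) (x y : X) : ℝ := G.resolventKernel q (-α) x y

theorem FormNonneg.green_spec (hq : G.FormNonneg q) {α : ℝ} (hα : 0 < α) (x : X) :
    ∃ u : EllTwo X, G.IsOperatorValue q u (ellTwoSingle x - α • u) ∧ ∀ y, G.green q α x y = u y :=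
  ⟨_, hq.resolvent_spec hα _, fun _ => rfl⟩

theorem FormNonneg.green_nonneg (hq : G.FormNonneg q) {α : ℝ} (hα : 0 < α) (x y : X) :
    0 ≤ G.green q α x y := by
  obtain ⟨u, hu, h⟩ := hq.green_spec hα x
  rw [h]
  exact hq.isOperatorValue_pos hα (ellTwoSingle_nonneg x) hu y

theorem FormNonneg.green_comm (hq : G.FormNonneg q) {α : ℝ} (hα : 0 < α) (x y : X) :
    G.green q α x y = G.green q α y x := by
  obtain ⟨u, hu, h⟩ := hq.green_spec hα x
  obtain ⟨v, hv, h'⟩ := hq.green_spec hα y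
  have h1 := hq.isOperatorValue_symm hu hv
  rw [inner_sub_left, inner_sub_right, real_inner_smul_left, real_inner_smul_right,
    inner_ellTwoSingle, inner_ellTwoSingle_left] at h1
  rw [h, h']
  linarith

/-- By the resolvent identity the difference solves `(H⁽¹⁾ + α) w = (β - α) G_β(x,·)`, whose right
side is nonnegative. -/
theorem FormNonneg.green_anti (hq : G.FormNonneg q) {α β : ℝ} (hα : 0 < α) (hαβ : α ≤ β)
    (x y : X) : G.green q β x y ≤ G.green q α x y := by
  obtain ⟨u, hu, h⟩ := hq.green_spec hα x
  obtain ⟨v, hv, h'⟩ := hq.green_spec (hα.trans_le hαβ) x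
  have h1 := hq.isOperatorValue_sub hu hv
  have h2 : ellTwoSingle x - α • u - (ellTwoSingle x - β • v) = (β - α) • v - α • (u - v) := by
    module
  rw [h2] at h1
  have h3 := hq.isOperatorValue_pos hα (f := (β - α) • v) (fun z => mul_nonneg (sub_nonneg.2 hαβ)
    (hq.isOperatorValue_pos (hα.trans_le hαβ) (ellTwoSingle_nonneg x) hv z)) h1 y
  rw [h, h']
  exact sub_nonneg.1 h3

theorem FormNonneg.green_equation (hq : G.FormNonneg q) {α : ℝ} (hα : 0 < α) (x y : X) :
    (Summable fun z => G.b y z * G.green q α x z) ∧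
      ∑' z, G.b y z * G.green q α x z =
        (G.deg y + q y + α) * G.green q α x y - ellTwoSingle x y := by
  obtain ⟨u, hu, h⟩ := hq.green_spec hα x
  simp only [h]
  obtain ⟨h1, h2⟩ := G.inner_opColumn q u y
  refine ⟨h1, ?_⟩
  have h3 := (hq.isOperatorValue_iff.1 hu).2 (Finsupp.single y 1)
  rw [opEll_single, h2, ← ellTwoSingle, inner_ellTwoSingle] at h3
  have h4 : (ellTwoSingle x - α • u) y = ellTwoSingle x y - α * u y := rfl
  rw [h4] at h3
  linarith

/-- The last clause is the reproducing property of `u = G_α(x,·)` for `h + α‖·‖²`; the limit before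
it is the closed form at `u`. -/
theorem FormNonneg.green_approx (hq : G.FormNonneg q) {α : ℝ} (hα : 0 < α) (x : X) :
    ∃ (u : EllTwo X) (φ : ℕ → X →₀ ℝ), u x = G.green q α x x ∧ G.IsFormApprox q φ u ∧
      Tendsto (fun n => G.form q (φ n) (φ n)) atTop (𝓝 (u x - α * ‖u‖ ^ 2)) ∧
      ∀ ψ, inner ℝ u (G.opEll q ψ) + α * inner ℝ u (ellTwoIncl X ψ) = ψ x := by
  obtain ⟨u, hu, h⟩ := hq.green_spec hα x
  obtain ⟨φ, hφ⟩ := hu.1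
  refine ⟨u, φ, (h x).symm, hφ, ?_, fun ψ => ?_⟩
  · convert hq.tendsto_closedForm hφ hφ using 2
    rw [hu.2 u hu.1, inner_sub_left, inner_ellTwoSingle_left, real_inner_smul_left,
      real_inner_self_eq_norm_sq]
  · rw [(hq.isOperatorValue_iff.1 hu).2, inner_sub_left, inner_ellTwoSingle_left,
      real_inner_smul_left, ellTwoIncl_apply]
    ring

/-- Cauchy–Schwarz for `h + α‖·‖²` between `ψ` and the reproducing element, whose energy is
`G_α(x,x)`. The discriminant is taken after passing to the limit in `φ n + t ψ`. -/
theorem FormNonneg.sq_apply_le_green (hq : G.FormNonneg q) {α : ℝ} (hα : 0 < α) (x : X)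
    (ψ : X →₀ ℝ) :
    ψ x ^ 2 ≤ G.green q α x x * (G.form q ψ ψ + α * ‖ellTwoIncl X ψ‖ ^ 2) := by
  obtain ⟨u, φ, hux, hφ, hlim, heq⟩ := hq.green_approx hα x
  have key : ∀ t : ℝ, 0 ≤ (G.form q ψ ψ + α * ‖ellTwoIncl X ψ‖ ^ 2) * (t * t) + (2 * ψ x) * t +
      u x := by
    intro t
    have h1 : Tendsto (fun n => (G.form q (φ n) (φ n) + α * ‖ellTwoIncl X (φ n)‖ ^ 2) +
        2 * t * (inner ℝ (ellTwoIncl X (φ n)) (G.opEll q ψ) +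
          α * inner ℝ (ellTwoIncl X (φ n)) (ellTwoIncl X ψ)) +
        t ^ 2 * (G.form q ψ ψ + α * ‖ellTwoIncl X ψ‖ ^ 2)) atTop
        (𝓝 ((u x - α * ‖u‖ ^ 2 + α * ‖u‖ ^ 2) + 2 * t * (inner ℝ u (G.opEll q ψ) +
          α * inner ℝ u (ellTwoIncl X ψ)) +
          t ^ 2 * (G.form q ψ ψ + α * ‖ellTwoIncl X ψ‖ ^ 2))) :=
      ((hlim.add ((hφ.1.norm.pow 2).const_mul α)).add (((hφ.1.inner tendsto_const_nhds).add
        ((hφ.1.inner tendsto_const_nhds).const_mul α)).const_mul (2 * t))).add_const _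
    rw [heq] at h1
    have h2 := ge_of_tendsto' h1 (b := 0) fun n => by
      have h3 : 0 ≤ G.form q (φ n + t • ψ) (φ n + t • ψ) + α * ‖ellTwoIncl X (φ n + t • ψ)‖ ^ 2 :=
        add_nonneg (hq _) (by positivity)
      rw [← form_eq_inner']
      simp only [map_smul, map_add, form_smul_left,
        form_smul_right, form_add_left, form_add_right, norm_smul,
        mul_pow, inner_smul_right, norm_add_sq_real,
        G.form_comm q ψ (φ n), Real.norm_eq_abs, sq_abs] at h3
      linarith
    linarith
  have h := discrim_le_zero key
  rw [discrim, hux] at h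
  linarith

/-- The form is bounded below by a multiple of the point mass at `x`. -/
def PointBound (G : WeightedGraph X) (q : X → ℝ) (x : X) : Prop :=
  ∃ c : ℝ, 0 < c ∧ ∀ φ : X →₀ ℝ, c * φ x ^ 2 ≤ G.form q φ φ

/-- The Green function stays bounded as the spectral parameter tends to zero. -/
def GreenBounded (G : WeightedGraph X) (q : X → ℝ) (x y : X) : Prop :=
  ∃ C : ℝ, ∀ α : ℝ, 0 < α → α ≤ 1 → G.green q α x y ≤ C

/-- Forward, the point bound applied to `u = G_α(x,·)` gives `c u(x)² ≤ u(x) - α‖u‖² ≤ u(x)`.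
Backward, let `α ↘ 0` in `sq_apply_le_green`. -/
theorem FormNonneg.pointBound_iff_greenBounded (hq : G.FormNonneg q) (x : X) :
    G.PointBound q x ↔ G.GreenBounded q x x := by
  constructor
  · rintro ⟨c, hc, h⟩
    refine ⟨1 / c, fun α hα _ => ?_⟩
    obtain ⟨u, φ, hux, hφ, hlim, -⟩ := hq.green_approx hα x
    rw [← hux]
    have h1 : c * u x ^ 2 ≤ u x - α * ‖u‖ ^ 2 :=
      le_of_tendsto_of_tendsto' (((tendsto_ellTwo_apply hφ.1 x).pow 2).const_mul c) hlim
        fun n => h (φ n)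
    have h2 : 0 ≤ α * ‖u‖ ^ 2 := by positivity
    have h3 : 0 ≤ u x := hux ▸ hq.green_nonneg hα x x
    rw [le_div_iff₀ hc]
    rcases h3.eq_or_lt with h0 | h0
    · rw [← h0]; norm_num
    · refine le_of_mul_le_mul_right ?_ h0
      linarith
  · rintro ⟨C, hC⟩
    refine ⟨1 / (|C| + 1), by positivity, fun φ => ?_⟩
    have hlim : Tendsto (fun α : ℝ => (|C| + 1) * (G.form q φ φ + α * ‖ellTwoIncl X φ‖ ^ 2))
        (𝓝[>] 0) (𝓝 ((|C| + 1) * (G.form q φ φ + 0 * ‖ellTwoIncl X φ‖ ^ 2))) :=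
      (Continuous.tendsto (by fun_prop) 0).mono_left nhdsWithin_le_nhds
    have h1 : φ x ^ 2 ≤ (|C| + 1) * (G.form q φ φ + 0 * ‖ellTwoIncl X φ‖ ^ 2) := by
      refine ge_of_tendsto hlim ?_
      filter_upwards [Ioc_mem_nhdsGT (zero_lt_one (α := ℝ))] with α hα
      refine (hq.sq_apply_le_green hα.1 x φ).trans (mul_le_mul_of_nonneg_right ?_
        (add_nonneg (hq _) (mul_nonneg hα.1.le (sq_nonneg _))))
      exact (hC α hα.1 hα.2).trans ((le_abs_self C).trans (by linarith))
    rw [zero_mul, add_zero] at h1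
    rw [one_div, inv_mul_le_iff₀ (by positivity)]
    exact h1

/-- Monotonicity in `α = -lam` upgrades unboundedness to divergence. -/
theorem FormNonneg.not_greenBounded_iff (hq : G.FormNonneg q) (x y : X) :
    ¬ G.GreenBounded q x y ↔
      Tendsto (fun lam : ℝ => G.resolventKernel q lam x y) (𝓝[<] 0) atTop := by
  constructor
  · intro h
    rw [tendsto_atTop]
    intro C
    simp only [GreenBounded, not_exists, not_forall, not_le] at h
    obtain ⟨α, hα, -, hC⟩ := h C
    filter_upwards [Ico_mem_nhdsLT (neg_neg_of_pos hα)] with lam hlam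
    have := hq.green_anti (α := -lam) (β := α) (by linarith [hlam.2]) (by linarith [hlam.1]) x y
    rw [green.eq_def G q (-lam), neg_neg] at this
    linarith
  · rintro h ⟨C, hC⟩
    obtain ⟨lam, hlam, h1⟩ := ((h.eventually_gt_atTop C).and
      (Ico_mem_nhdsLT (neg_neg_of_pos zero_lt_one))).exists
    have := hC (-lam) (by linarith [h1.2]) (by linarith [h1.1])
    rw [green, neg_neg] at this
    linarith

/-! ### The heat kernel and its Laplace transform -/

theorem FormNonneg.heatKernel_nonneg (hq : G.FormNonneg q) {t : ℝ} (ht : 0 ≤ t) (x y : X) :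
    0 ≤ G.heatKernel q t x y := by
  refine hq.isHeatSemigroup.mem_of_cone hq.isMAccretive (K := {f : EllTwo X | ∀ y, 0 ≤ f y})
    ?_ (fun y => le_rfl) (fun f hf g hg y => add_nonneg (hf y) (hg y))
    (fun a ha f hf y => mul_nonneg ha (hf y))
    (fun α hα f hf u hu => hq.isOperatorValue_pos hα hf hu) ht (ellTwoSingle_nonneg x) y
  simp only [Set.ofPred_forall, ← inner_ellTwoSingle]
  exact isClosed_iInter fun y => isClosed_le continuous_const (by fun_prop)

theorem FormNonneg.continuousOn_heatKernel (hq : G.FormNonneg q) (x y : X) :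
    ContinuousOn (fun s => G.heatKernel q s x y) (Set.Ici 0) := by
  refine ((hq.isHeatSemigroup.continuousOn (ellTwoSingle x)).inner
    (continuousOn_const (c := ellTwoSingle y))).congr fun s _ => ?_
  exact (inner_ellTwoSingle _ y).symm

theorem FormNonneg.intervalIntegrable_heatKernel (hq : G.FormNonneg q) (x y : X) {s t : ℝ}
    (hs : 0 ≤ s) (ht : 0 ≤ t) :
    IntervalIntegrable (fun s => G.heatKernel q s x y) MeasureTheory.volume s t :=
  ((hq.continuousOn_heatKernel x y).mono fun _ hr =>
    (le_min hs ht).trans hr.1).intervalIntegrable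

/-- The Laplace transform of the heat kernel is the Green function. -/
theorem FormNonneg.tendsto_integral_exp_heatKernel (hq : G.FormNonneg q) {α : ℝ} (hα : 0 < α)
    (x y : X) : Tendsto (fun t : ℝ => ∫ s in (0 : ℝ)..t, Real.exp (-(α * s)) * G.heatKernel q s x y)
      atTop (𝓝 (G.green q α x y)) := by
  obtain ⟨u, hu, h⟩ := hq.green_spec hα x
  have hT := hq.isHeatSemigroup
  have h1 : ∀ t, 0 ≤ t → ∫ s in (0 : ℝ)..t, Real.exp (-(α * s)) * G.heatKernel q s x y =
      u y - Real.exp (-(α * t)) * G.heatSemigroup q t u y := by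
    intro t ht
    have h2 := congrArg (innerSL ℝ (ellTwoSingle y)) (hT.integral_exp_smul hu ht)
    rw [← ContinuousLinearMap.intervalIntegral_comp_comm] at h2
    · simp only [innerSL_apply_apply, real_inner_smul_right, inner_sub_right,
        inner_ellTwoSingle_left] at h2
      exact h2
    · have he : Continuous fun s : ℝ => Real.exp (-(α * s)) := by fun_prop
      refine ContinuousOn.intervalIntegrable (he.continuousOn.smul
        ((hT.continuousOn _).mono fun s hs => ?_))
      rw [Set.uIcc_of_le ht] at hs
      exact hs.1
  have h3 : Tendsto (fun t => Real.exp (-(α * t)) * G.heatSemigroup q t u y) atTop (𝓝 0) := by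
    have h4 : Tendsto (fun t => Real.exp (-(α * t)) * (‖u‖ * ‖ellTwoSingle y‖)) atTop (𝓝 0) := by
      simpa using (Real.tendsto_exp_neg_atTop_nhds_zero.comp
        (tendsto_id.const_mul_atTop hα)).mul_const (‖u‖ * ‖ellTwoSingle y‖)
    refine squeeze_zero_norm' ?_ h4
    filter_upwards [eventually_ge_atTop 0] with t ht
    rw [norm_mul, Real.norm_of_nonneg (Real.exp_pos _).le, ← inner_ellTwoSingle]
    refine mul_le_mul_of_nonneg_left ?_ (Real.exp_pos _).le
    exact (norm_inner_le_norm _ _).trans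
      (mul_le_mul_of_nonneg_right (hT.norm_le hq.isMAccretive hu ht) (norm_nonneg _))
  rw [h]
  have h5 := h3.const_sub (u y)
  rw [sub_zero] at h5
  refine h5.congr' ?_
  filter_upwards [eventually_ge_atTop 0] with t ht
  rw [h1 t ht]

theorem FormNonneg.integral_heatKernel_mono (hq : G.FormNonneg q) (x y : X) {s t : ℝ}
    (hs : 0 ≤ s) (hst : s ≤ t) :
    ∫ r in (0 : ℝ)..s, G.heatKernel q r x y ≤ ∫ r in (0 : ℝ)..t, G.heatKernel q r x y := by
  rw [← intervalIntegral.integral_add_adjacent_intervals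
    (hq.intervalIntegrable_heatKernel x y le_rfl hs)
    (hq.intervalIntegrable_heatKernel x y hs (hs.trans hst))]
  refine le_add_of_nonneg_right (intervalIntegral.integral_nonneg hst fun r hr => ?_)
  exact hq.heatKernel_nonneg (hs.trans hr.1) x y

theorem FormNonneg.intervalIntegrable_exp_heatKernel (hq : G.FormNonneg q) (α : ℝ) (x y : X)
    {s t : ℝ} (hs : 0 ≤ s) (ht : 0 ≤ t) : IntervalIntegrable
      (fun s => Real.exp (-(α * s)) * G.heatKernel q s x y) MeasureTheory.volume s t :=
  (ContinuousOn.mul (by fun_prop) ((hq.continuousOn_heatKernel x y).mono fun _ hr =>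
    (le_min hs ht).trans hr.1)).intervalIntegrable

/-- The kernel is nonnegative and `e^{-αt} ≤ e^{-αs} ≤ 1` on `[0, t]`, so its integrals and its
Laplace transforms are bounded together as `t → ∞` and `α ↘ 0`. -/
theorem FormNonneg.not_greenBounded_iff_integral (hq : G.FormNonneg q) (x y : X) :
    ¬ G.GreenBounded q x y ↔
      Tendsto (fun t : ℝ => ∫ s in (0 : ℝ)..t, G.heatKernel q s x y) atTop atTop := by
  constructor
  · intro h
    rw [tendsto_atTop]
    intro C
    simp only [GreenBounded, not_exists, not_forall, not_le] at h
    obtain ⟨α, hα, -, hC⟩ := h C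
    obtain ⟨t, htC, ht⟩ := (((hq.tendsto_integral_exp_heatKernel hα x y).eventually_const_lt hC).and
      (eventually_ge_atTop 0)).exists
    filter_upwards [eventually_ge_atTop t] with s hs
    refine htC.le.trans (le_trans ?_ (hq.integral_heatKernel_mono x y ht hs))
    refine intervalIntegral.integral_mono_on ht
      (hq.intervalIntegrable_exp_heatKernel α x y le_rfl ht)
      (hq.intervalIntegrable_heatKernel x y le_rfl ht) fun r hr => ?_
    refine mul_le_of_le_one_left (hq.heatKernel_nonneg hr.1 x y) (Real.exp_le_one_iff.2 ?_)
    have := mul_nonneg hα.le hr.1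
    linarith
  · rintro h ⟨C, hC⟩
    obtain ⟨t, htC, ht⟩ := ((h.eventually_gt_atTop C).and (eventually_ge_atTop 0)).exists
    refine htC.not_ge ?_
    have hlim : Tendsto (fun α : ℝ => Real.exp (-(α * t)) * ∫ s in (0 : ℝ)..t, G.heatKernel q s x y)
        (𝓝[>] 0) (𝓝 (Real.exp (-(0 * t)) * ∫ s in (0 : ℝ)..t, G.heatKernel q s x y)) :=
      (Continuous.tendsto (by fun_prop) 0).mono_left nhdsWithin_le_nhds
    rw [zero_mul, neg_zero, Real.exp_zero, one_mul] at hlim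
    refine le_of_tendsto hlim ?_
    filter_upwards [Ioc_mem_nhdsGT (zero_lt_one (α := ℝ))] with α hα
    refine le_trans ?_ (hC α hα.1 hα.2)
    refine ge_of_tendsto (hq.tendsto_integral_exp_heatKernel hα.1 x y) ?_
    filter_upwards [eventually_ge_atTop t] with s hs
    rw [← intervalIntegral.integral_const_mul,
      ← intervalIntegral.integral_add_adjacent_intervals
        (hq.intervalIntegrable_exp_heatKernel α x y le_rfl ht)
        (hq.intervalIntegrable_exp_heatKernel α x y ht (ht.trans hs))]
    refine le_add_of_le_of_nonneg (intervalIntegral.integral_mono_on ht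
      ((hq.intervalIntegrable_heatKernel x y le_rfl ht).const_mul _)
      (hq.intervalIntegrable_exp_heatKernel α x y le_rfl ht) fun r hr => ?_)
      (intervalIntegral.integral_nonneg hs fun r hr => mul_nonneg (Real.exp_pos _).le
        (hq.heatKernel_nonneg (ht.trans hr.1) x y))
    refine mul_le_mul_of_nonneg_right (Real.exp_le_exp.2 ?_) (hq.heatKernel_nonneg hr.1 x y)
    have := mul_le_mul_of_nonneg_left hr.2 hα.1.le
    linarith

/-! ### Harnack's inequality -/

/-- Harnack's inequality. -/
theorem harnack (hG : G.Connected) (q : X → ℝ) (x y : X) :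
    ∃ C : ℝ, 0 < C ∧ ∀ α : ℝ, α ≤ 1 → ∀ u : X → ℝ, (∀ z, 0 ≤ u z) →
      (∀ z, Summable fun w => G.b z w * u w) →
      (∀ z, ∑' w, G.b z w * u w ≤ (G.deg z + q z + α) * u z) → u y ≤ C * u x := by
  induction hG x y with
  | refl => exact ⟨1, one_pos, fun _ _ u _ _ _ => by rw [one_mul]⟩
  | @tail z y _ hzy ih =>
    obtain ⟨C, hC, h⟩ := ih
    have hzy' : 0 < G.b z y := hzy
    -- One neighbour term is at most the full sum: `b(z,y) u(y) ≤ (deg z + q(z) + α) u(z)`, and `α ≤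
    -- 1` keeps the constant uniform.
    refine ⟨(|G.deg z + q z| + 1) / G.b z y * C, by positivity, fun α hα u hu hs hle => ?_⟩
    have h1 := h α hα u hu hs hle
    have h2 : G.b z y * u y ≤ (|G.deg z + q z| + 1) * u z :=
      ((hs z).le_tsum y fun w _ => mul_nonneg (G.nonneg z w) (hu w)).trans ((hle z).trans
        (mul_le_mul_of_nonneg_right (add_le_add (le_abs_self _) hα) (hu z)))
    rw [div_mul_eq_mul_div, div_mul_eq_mul_div, le_div_iff₀ hzy', mul_comm (u y), mul_assoc]
    exact h2.trans (by gcongr)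

theorem FormNonneg.green_harnack (hq : G.FormNonneg q) (hG : G.Connected) (x y : X) :
    ∃ C : ℝ, 0 < C ∧ ∀ α : ℝ, 0 < α → α ≤ 1 → ∀ o, G.green q α o y ≤ C * G.green q α o x := by
  obtain ⟨C, hC, h⟩ := harnack hG q x y
  refine ⟨C, hC, fun α hα hα1 o => h α hα1 _ (hq.green_nonneg hα o)
    (fun z => (hq.green_equation hα o z).1) fun z => ?_⟩
  rw [(hq.green_equation hα o z).2]
  linarith [ellTwoSingle_nonneg o z]

/-- Harnack in each argument separately, using the symmetry of the Green function. -/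
theorem FormNonneg.greenBounded_of (hq : G.FormNonneg q) (hG : G.Connected) {x y : X}
    (h : G.GreenBounded q x y) (x' y' : X) : G.GreenBounded q x' y' := by
  obtain ⟨C, hC⟩ := h
  obtain ⟨D, hD, h1⟩ := hq.green_harnack hG y y'
  obtain ⟨D', hD', h2⟩ := hq.green_harnack hG x x'
  refine ⟨D' * (D * C), fun α hα hα1 => ?_⟩
  rw [hq.green_comm hα]
  refine (h2 α hα hα1 y').trans (mul_le_mul_of_nonneg_left ?_ hD'.le)
  rw [hq.green_comm hα]
  exact (h1 α hα hα1 x).trans (mul_le_mul_of_nonneg_left (hC α hα hα1) hD.le)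

/-! ### Criticality, capacity and null-sequences -/

theorem subcritical_iff : G.Subcritical q ↔ ∃ x, G.PointBound q x := by
  classical
  constructor
  · rintro ⟨w, ⟨hw, hw0⟩, h⟩
    obtain ⟨x, hx⟩ := Function.ne_iff.1 hw0
    refine ⟨x, w x, lt_of_le_of_ne (hw x) (Ne.symm hx), fun φ => ?_⟩
    refine le_trans ?_ (sub_nonneg.1 (h φ))
    have hs : Summable fun y => w y * φ y ^ 2 :=
      summable_of_hasFiniteSupport (φ.hasFiniteSupport.subset fun y hy => by
        simp only [Function.mem_support] at hy ⊢; contrapose! hy; simp [hy])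
    exact hs.le_tsum x fun y _ => mul_nonneg (hw y) (sq_nonneg _)
  · rintro ⟨x, c, hc, h⟩
    refine ⟨Pi.single x c, ⟨fun y => ?_, fun h0 => ?_⟩, fun φ => sub_nonneg.2 ?_⟩
    · by_cases hy : y = x
      · subst hy; simpa using hc.le
      · simp [hy]
    · have := congrFun h0 x
      simp [hc.ne'] at this
    · rw [tsum_eq_single x fun y hy => by simp [hy], Pi.single_eq_same]
      exact h φ

theorem critical_iff : G.Critical q ↔ ∀ x, ¬ G.PointBound q x := by
  rw [Critical, subcritical_iff, not_exists]

theorem FormNonneg.capacity_eq_zero_iff (hq : G.FormNonneg q) (x : X) :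
    G.capacity q x = 0 ↔ ¬ G.PointBound q x := by
  have hne : {r | ∃ φ : X →₀ ℝ, φ x = 1 ∧ r = G.form q φ φ}.Nonempty :=
    ⟨_, Finsupp.single x 1, by simp, rfl⟩
  have hbdd : BddBelow {r | ∃ φ : X →₀ ℝ, φ x = 1 ∧ r = G.form q φ φ} :=
    ⟨0, by rintro _ ⟨φ, -, rfl⟩; exact hq φ⟩
  have h0 : 0 ≤ G.capacity q x := le_csInf hne (by rintro _ ⟨φ, -, rfl⟩; exact hq φ)
  constructor
  · rintro h ⟨c, hc, hφ⟩
    have : c ≤ G.capacity q x := le_csInf hne (by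
      rintro _ ⟨φ, h1, rfl⟩
      simpa [h1] using hφ φ)
    linarith
  · intro h
    by_contra hne0
    refine h ⟨G.capacity q x, lt_of_le_of_ne h0 (Ne.symm hne0), fun φ => ?_⟩
    rcases eq_or_ne (φ x) 0 with hx | hx
    · simpa [hx] using hq φ
    · have h1 : G.capacity q x ≤ G.form q ((φ x)⁻¹ • φ) ((φ x)⁻¹ • φ) :=
        csInf_le hbdd ⟨_, by simp [hx], rfl⟩
      rw [form_smul_left, form_smul_right] at h1
      calc _ ≤ (φ x)⁻¹ * ((φ x)⁻¹ * G.form q φ φ) * φ x ^ 2 := by gcongr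
        _ = G.form q φ φ := by field_simp

/-- Capacity zero supplies test functions of small energy with value 1 at `o`; absolute values make
them positive without raising the energy. -/
theorem FormNonneg.exists_nullSequence (hq : G.FormNonneg q) {o : X} (ho : ¬ G.PointBound q o)
    {c : ℝ} (hc : 0 < c) : ∃ e : ℕ → X →₀ ℝ, G.IsNullSequence q e ∧ ∀ n, e n o = c := by
  have h1 : ∀ n : ℕ, ∃ φ : X →₀ ℝ, φ o = 1 ∧ G.form q φ φ ≤ 1 / ((n : ℝ) + 1) := by
    intro n
    have h2 := (hq.capacity_eq_zero_iff o).2 ho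
    obtain ⟨_, ⟨φ, h3, rfl⟩, h4⟩ := Real.lt_sInf_add_pos
      (s := {r | ∃ φ : X →₀ ℝ, φ o = 1 ∧ r = G.form q φ φ}) ⟨_, Finsupp.single o 1, by simp, rfl⟩
      (ε := 1 / ((n : ℝ) + 1)) (by positivity)
    rw [← capacity, h2, zero_add] at h4
    exact ⟨φ, h3, h4.le⟩
  choose φ hφ hφ' using h1
  have hco : ∀ n, (c • absFinsupp (φ n)) o = c := fun n => by simp [hφ]
  refine ⟨fun n => c • absFinsupp (φ n), ⟨fun n => ⟨fun x => ?_, fun h0 => ?_⟩, ⟨o, c, hc, hco⟩, ?_⟩,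
    hco⟩
  · exact mul_nonneg hc.le (abs_nonneg _)
  · have := congrFun h0 o
    rw [hco] at this
    exact hc.ne' this
  · have hlim : Tendsto (fun n : ℕ => c * (c * (1 / ((n : ℝ) + 1)))) atTop (𝓝 0) := by
      simpa using (tendsto_one_div_add_atTop_nhds_zero_nat.const_mul c).const_mul c
    refine squeeze_zero (fun n => hq _) (fun n => ?_) hlim
    rw [form_smul_left, form_smul_right]
    have := (G.form_absFinsupp_le q (φ n)).trans (hφ' n)
    gcongr

theorem IsNullSequence.exists_not_pointBound {e : ℕ → X →₀ ℝ} (he : G.IsNullSequence q e) :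
    ∃ o, (∀ c : ℝ, 0 < c → (∀ n, e n o = c) → ¬ G.PointBound q o) ∧ ∃ c, 0 < c ∧ ∀ n, e n o = c := by
  obtain ⟨-, ⟨o, c, hc, hco⟩, hlim⟩ := he
  refine ⟨o, ?_, c, hc, hco⟩
  rintro c hc hco ⟨k, hk, h⟩
  have h1 : k * c ^ 2 ≤ 0 := ge_of_tendsto' hlim fun n => by
    have := h (e n)
    rwa [hco] at this
  have : 0 < k * c ^ 2 := by positivity
  linarith

/-! ### Positive superharmonic functions -/

variable {u : X → ℝ}

theorem IsPosSuperharmonic.pos (hu : G.IsPosSuperharmonic q u) (hG : G.Connected) (x : X) :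
    0 < u x := by
  obtain ⟨⟨h0, hne⟩, hF, hs⟩ := hu
  obtain ⟨y, hy⟩ := Function.ne_iff.1 hne
  obtain ⟨C, hC, h⟩ := harnack hG q x y
  have h1 := h 0 zero_le_one u h0 hF.summable fun z => by
    have := hs z
    rw [hF.schrodinger_eq] at this
    linarith
  have h2 : 0 < u y := lt_of_le_of_ne (h0 y) (Ne.symm hy)
  exact pos_of_mul_pos_right (h2.trans_le h1) hC.le

theorem exists_quotient {u : X → ℝ} (hu : ∀ x, 0 < u x) (φ : X →₀ ℝ) :
    ∃ ψ : X →₀ ℝ, (∀ x, φ x = u x * ψ x) ∧ ∀ x, ψ x = φ x / u x := by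
  have h : ∃ ψ : X →₀ ℝ, ∀ x, ψ x = φ x / u x :=
    ⟨Finsupp.onFinset φ.support (fun x => φ x / u x) fun x hx => by
      rw [Finsupp.mem_support_iff]; rintro h0; simp [h0] at hx, fun x => rfl⟩
  obtain ⟨ψ, hψ⟩ := h
  exact ⟨ψ, fun x => by rw [hψ, mul_div_cancel₀ _ (hu x).ne'], hψ⟩

/-- The ground state representation gives `h(φ) ≥ ∑ (Hu/u) φ²`, so `Hu(x) > 0` would be a point
bound at `x`. -/
theorem IsPosSuperharmonic.isHarmonic (hu : G.IsPosSuperharmonic q u) (hG : G.Connected)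
    (hc : G.Critical q) : G.IsHarmonic q u := by
  have hpos := hu.pos hG
  refine ⟨hu.2.1, fun x => ?_⟩
  by_contra hne
  refine critical_iff.1 hc x ⟨G.schrodinger q u x / u x, div_pos
    (lt_of_le_of_ne (hu.2.2 x) (Ne.symm hne)) (hpos x), fun φ => ?_⟩
  obtain ⟨ψ, hψ, -⟩ := exists_quotient hpos φ
  have h1 := (hu.2.1.hasSum_groundState q hψ).nonneg fun p => mul_nonneg
    (mul_nonneg (G.nonneg _ _) (mul_nonneg (hpos _).le (hpos _).le)) (sq_nonneg _)
  have hs : Summable fun y => G.schrodinger q u y * u y * ψ y ^ 2 :=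
    summable_of_hasFiniteSupport (ψ.hasFiniteSupport.subset fun y hy => by
      simp only [Function.mem_support] at hy ⊢; contrapose! hy; simp [hy])
  have h2 := hs.le_tsum x fun y _ => mul_nonneg (mul_nonneg (hu.2.2 y) (hpos y).le) (sq_nonneg _)
  have h3 : G.schrodinger q u x / u x * φ x ^ 2 = G.schrodinger q u x * u x * ψ x ^ 2 := by
    rw [hψ]
    have := (hpos x).ne'
    field_simp
  linarith

theorem IsPosSuperharmonic.edge_le (hu : G.IsPosSuperharmonic q u) (hpos : ∀ x, 0 < u x)
    {φ ψ : X →₀ ℝ} (hψ : ∀ x, φ x = u x * ψ x) (x y : X) :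
    G.b x y * (u x * u y) * (ψ x - ψ y) ^ 2 ≤ 2 * G.form q φ φ := by
  have h1 := hu.2.1.hasSum_groundState q hψ
  have h2 := le_hasSum h1 (x, y) fun p _ => mul_nonneg
    (mul_nonneg (G.nonneg _ _) (mul_nonneg (hpos _).le (hpos _).le)) (sq_nonneg _)
  have h3 : 0 ≤ ∑' x, G.schrodinger q u x * u x * ψ x ^ 2 :=
    tsum_nonneg fun x => mul_nonneg (mul_nonneg (hu.2.2 x) (hpos x).le) (sq_nonneg _)
  linarith

/-- Null-sequences converge to multiples of positive superharmonic functions. -/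
theorem IsPosSuperharmonic.tendsto_of_form_tendsto_zero (hu : G.IsPosSuperharmonic q u)
    (hG : G.Connected) {e : ℕ → X →₀ ℝ}
    (he : Tendsto (fun n => G.form q (e n) (e n)) atTop (𝓝 0)) {o : X} {a : ℝ}
    (ho : ∀ n, e n o = a * u o) (x : X) : Tendsto (fun n => e n x) atTop (𝓝 (a * u x)) := by
  have hpos := hu.pos hG
  choose ψ hψ hψ' using fun n => exists_quotient hpos (e n)
  suffices h : Tendsto (fun n => ψ n x) atTop (𝓝 a) by
    simp only [hψ]
    simpa [mul_comm] using h.const_mul (u x)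
  -- Along a path from `o` the quotients `ψ n = e n / u` keep the limit `a`, because `edge_le` kills
  -- their increments over each edge.
  induction hG o x with
  | refl =>
    refine tendsto_const_nhds.congr fun n => ?_
    rw [hψ', ho, mul_div_cancel_right₀ _ (hpos o).ne']
  | @tail z y _ hzy ih =>
    have hk : 0 < G.b z y * (u z * u y) := mul_pos hzy (mul_pos (hpos z) (hpos y))
    have h1 : Tendsto (fun n => 2 * G.form q (e n) (e n) / (G.b z y * (u z * u y))) atTop (𝓝 0) := by
      simpa using (he.const_mul 2).div_const (G.b z y * (u z * u y))
    have h2 : Tendsto (fun n => (ψ n z - ψ n y) ^ 2) atTop (𝓝 0) :=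
      squeeze_zero (fun n => sq_nonneg _) (fun n => by
        rw [le_div_iff₀' hk]
        exact hu.edge_le hpos (hψ n) z y) h1
    have h3 : Tendsto (fun n => ψ n z - ψ n y) atTop (𝓝 0) := by
      rw [tendsto_zero_iff_abs_tendsto_zero]
      simpa [Function.comp_def, Real.sqrt_sq_eq_abs] using (Real.continuous_sqrt.tendsto 0).comp h2
    simpa using ih.sub h3

/-- A single null-sequence converges to multiples of both functions; limits are unique. -/
theorem IsPosSuperharmonic.eq_smul (hq : G.FormNonneg q) (hG : G.Connected) (hc : G.Critical q)
    {v : X → ℝ} (hu : G.IsPosSuperharmonic q u) (hv : G.IsPosSuperharmonic q v) :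
    ∃ c : ℝ, 0 < c ∧ v = c • u := by
  obtain ⟨o, -⟩ := Function.ne_iff.1 hu.1.2
  obtain ⟨e, he, heo⟩ := hq.exists_nullSequence (critical_iff.1 hc o) (hu.pos hG o)
  have hvo := hv.pos hG o
  have huo := hu.pos hG o
  refine ⟨v o / u o, div_pos hvo huo, funext fun x => ?_⟩
  have h1 := hu.tendsto_of_form_tendsto_zero hG he.2.2 (o := o) (a := 1)
    (fun n => by rw [heo, one_mul]) x
  have h2 := hv.tendsto_of_form_tendsto_zero hG he.2.2 (o := o) (a := u o / v o)
    (fun n => by rw [heo, div_mul_cancel₀ _ hvo.ne']) x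
  have h3 := tendsto_nhds_unique h1 h2
  rw [one_mul] at h3
  rw [Pi.smul_apply, smul_eq_mul, h3]
  field_simp

theorem memF_of_nonneg {f : X → ℝ} (hf : ∀ x, 0 ≤ f x)
    (h : ∀ x, Summable fun y => G.b x y * f y) : G.MemF f := by
  intro x
  simpa only [abs_of_nonneg (hf _)] using h x

theorem FormNonneg.green_self_pos (hq : G.FormNonneg q) {α : ℝ} (hα : 0 < α) (x : X) :
    0 < G.green q α x x := by
  have h := hq.sq_apply_le_green hα x (Finsupp.single x 1)
  rw [Finsupp.single_eq_same, one_pow] at h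
  refine lt_of_le_of_ne (hq.green_nonneg hα x x) fun h0 => ?_
  rw [← h0, zero_mul] at h
  linarith

/-- Passing to the limit in approximate supersolutions. -/
theorem summable_and_tsum_le_of_tendsto {ι : Type*} {l : Filter ι} [l.NeBot] {g : ι → X → ℝ}
    {a : ι → ℝ} {A : ℝ} {x : X} (hg : Tendsto a l (𝓝 A)) (hu0 : ∀ y, 0 ≤ u y)
    (hu : ∀ y, Tendsto (fun i => g i y) l (𝓝 (u y)))
    (h : ∀ᶠ i in l, (∀ y, 0 ≤ g i y) ∧ (Summable fun y => G.b x y * g i y) ∧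
      ∑' y, G.b x y * g i y ≤ a i) :
    (Summable fun y => G.b x y * u y) ∧ ∑' y, G.b x y * u y ≤ A := by
  have h1 : ∀ s : Finset X, ∑ y ∈ s, G.b x y * u y ≤ A := fun s =>
    le_of_tendsto_of_tendsto (tendsto_finsetSum s fun y _ => (hu y).const_mul (G.b x y)) hg (by
      filter_upwards [h] with i hi
      exact (hi.2.1.sum_le_tsum s fun y _ => mul_nonneg (G.nonneg _ _) (hi.1 y)).trans hi.2.2)
  have h2 : Summable fun y => G.b x y * u y :=
    summable_of_sum_le (fun y => mul_nonneg (G.nonneg _ _) (hu0 y)) h1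
  exact ⟨h2, h2.tsum_le_of_sum_le h1⟩

/-- Normalise `G_α(o,·)` to be 1 at `o`. Harnack confines each value to a compact interval, an
ultrafilter refining `α ↘ 0` yields limits at all vertices at once, and a Fatou argument preserves
the supersolution inequality. -/
theorem FormNonneg.exists_isPosSuperharmonic [Nonempty X] (hq : G.FormNonneg q)
    (hG : G.Connected) : ∃ u, G.IsPosSuperharmonic q u := by
  obtain ⟨o⟩ := ‹Nonempty X›
  let U : Ultrafilter ℝ := Ultrafilter.of (𝓝[>] 0)
  have hU : (U : Filter ℝ) ≤ 𝓝[>] 0 := Ultrafilter.of_le _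
  let g : ℝ → X → ℝ := fun α x => G.green q α o x / G.green q α o o
  have hev : ∀ᶠ α in (U : Filter ℝ), α ∈ Set.Ioc (0 : ℝ) 1 := hU (Ioc_mem_nhdsGT zero_lt_one)
  have hg0 : ∀ α, 0 < α → ∀ x, 0 ≤ g α x := fun α hα x =>
    div_nonneg (hq.green_nonneg hα o x) (hq.green_nonneg hα o o)
  have hlim : ∀ x, ∃ l : ℝ, 0 ≤ l ∧ Tendsto (fun α => g α x) U (𝓝 l) := by
    intro x
    obtain ⟨C, hC, h⟩ := hq.green_harnack hG o x
    have hmem : ∀ᶠ α in (U : Filter ℝ), g α x ∈ Set.Icc 0 C := by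
      filter_upwards [hev] with α hα
      exact ⟨hg0 α hα.1 x, (div_le_iff₀ (hq.green_self_pos hα.1 o)).2 (h α hα.1 hα.2 o)⟩
    obtain ⟨l, hl, hl'⟩ := (isCompact_Icc (a := (0 : ℝ)) (b := C)).ultrafilter_le_nhds
      (U.map fun α => g α x) (le_principal_iff.2 hmem)
    exact ⟨l, hl.1, hl'⟩
  choose u hu0 hu using hlim
  have huo : u o = 1 := by
    refine tendsto_nhds_unique (hu o) (tendsto_const_nhds.congr' ?_)
    filter_upwards [hev] with α hα
    exact (div_self (hq.green_self_pos hα.1 o).ne').symm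
  have hid : Tendsto (fun α : ℝ => α) U (𝓝 0) := hU.trans nhdsWithin_le_nhds
  have key : ∀ x, (Summable fun y => G.b x y * u y) ∧
      ∑' y, G.b x y * u y ≤ (G.deg x + q x + 0) * u x := by
    intro x
    refine summable_and_tsum_le_of_tendsto ((hid.const_add (G.deg x + q x)).mul (hu x)) hu0 hu ?_
    filter_upwards [hev] with α hα
    obtain ⟨h1, h2⟩ := hq.green_equation hα.1 o x
    have h3 : ∀ y, G.b x y * g α y = G.b x y * G.green q α o y / G.green q α o o :=
      fun y => (mul_div_assoc _ _ _).symm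
    refine ⟨hg0 α hα.1, ?_, ?_⟩
    · simp only [h3]
      exact h1.div_const _
    · simp only [h3]
      rw [tsum_div_const, h2, ← mul_div_assoc]
      refine div_le_div_of_nonneg_right ?_ (hq.green_nonneg hα.1 o o)
      linarith [ellTwoSingle_nonneg o x]
  have hF : G.MemF u := memF_of_nonneg hu0 fun x => (key x).1
  refine ⟨u, ⟨hu0, fun h => ?_⟩, hF, fun x => ?_⟩
  · rw [h] at huo
    exact zero_ne_one huo
  · rw [hF.schrodinger_eq]
    have := (key x).2
    linarith

/-- Divided by `u`, truncation at `u` becomes truncation at 1, a contraction of the edge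
differences; harmonicity removes the potential term. -/
theorem IsHarmonic.form_inf_le (hu : G.IsHarmonic q u) (hpos : ∀ x, 0 < u x) {φ χ : X →₀ ℝ}
    (hχ : ∀ x, χ x = min (φ x) (u x)) : G.form q χ χ ≤ G.form q φ φ := by
  obtain ⟨ψ, hψ, hψ'⟩ := exists_quotient hpos φ
  obtain ⟨η, hη, hη'⟩ := exists_quotient hpos χ
  have h1 := hu.1.hasSum_groundState q hψ
  have h2 := hu.1.hasSum_groundState q hη
  simp only [hu.2, zero_mul, tsum_zero, sub_zero] at h1 h2
  have h3 : ∀ x, η x = min (ψ x) 1 := by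
    intro x
    rw [hη', hψ', hχ, ← div_self (hpos x).ne', min_div_div_right (hpos x).le]
  have h4 : ∀ x y, (η x - η y) ^ 2 ≤ (ψ x - ψ y) ^ 2 := fun x y => by
    rw [h3, h3, sq_le_sq]
    exact abs_inf_sub_inf_le_abs (ψ x) (ψ y) 1
  have h5 := hasSum_le (fun p : X × X => mul_le_mul_of_nonneg_left (h4 p.1 p.2)
    (mul_nonneg (G.nonneg p.1 p.2) (mul_nonneg (hpos p.1).le (hpos p.2).le))) h2 h1
  linarith

theorem FormNonneg.exists_dominated_nullSequence (hq : G.FormNonneg q) (hG : G.Connected)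
    (hc : G.Critical q) (hu : G.IsPosSuperharmonic q u) :
    ∃ e, G.IsNullSequence q e ∧ (∀ n x, 0 ≤ e n x ∧ e n x ≤ u x) ∧
      ∀ x, Tendsto (fun n => e n x) atTop (𝓝 (u x)) := by
  have hpos := hu.pos hG
  obtain ⟨o, -⟩ := Function.ne_iff.1 hu.1.2
  obtain ⟨φ, hφ, hφo⟩ := hq.exists_nullSequence (critical_iff.1 hc o) (hpos o)
  have h : ∀ n, ∃ χ : X →₀ ℝ, ∀ x, χ x = min (φ n x) (u x) := fun n =>
    ⟨Finsupp.onFinset (φ n).support (fun x => min (φ n x) (u x)) fun x hx => by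
      rw [Finsupp.mem_support_iff]; rintro h0; simp [h0, (hpos x).le] at hx, fun x => rfl⟩
  choose e he using h
  have heo : ∀ n, e n o = u o := fun n => by rw [he, hφo, min_self]
  have he0 : ∀ n x, 0 ≤ e n x := fun n x => by
    rw [he]; exact le_min ((hφ.1 n).1 x) (hpos x).le
  have hlim : Tendsto (fun n => G.form q (e n) (e n)) atTop (𝓝 0) :=
    squeeze_zero (fun n => hq _) (fun n => (hu.isHarmonic hG hc).form_inf_le hpos (he n)) hφ.2.2
  refine ⟨e, ⟨fun n => ⟨he0 n, fun h0 => ?_⟩, ⟨o, u o, hpos o, heo⟩, hlim⟩,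
    fun n x => ⟨he0 n x, ?_⟩, fun x => ?_⟩
  · have := congrFun h0 o
    rw [heo] at this
    exact (hpos o).ne' this
  · rw [he]; exact min_le_right _ _
  · simpa using hu.tendsto_of_form_tendsto_zero hG hlim (o := o) (a := 1) (by simpa using heo) x

/-! ### Linearly independent Green functions in the subcritical case -/

theorem FormNonneg.exists_greenFunction (hq : G.FormNonneg q)
    (hb : ∀ x y, G.GreenBounded q x y) (x : X) :
    ∃ g : X → ℝ, G.IsPosSuperharmonic q g ∧ ∀ y, G.schrodinger q g y = ellTwoSingle x y := by
  let a : ℕ → ℝ := fun n => 1 / ((n : ℝ) + 1)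
  have ha0 : ∀ n, 0 < a n := fun n => by positivity
  have ha1 : ∀ n, a n ≤ 1 := fun n => by
    rw [div_le_one (by positivity)]
    have : (0 : ℝ) ≤ n := n.cast_nonneg
    linarith
  have ha : Tendsto a atTop (𝓝 0) := tendsto_one_div_add_atTop_nhds_zero_nat
  have hmono : ∀ y, Monotone fun n => G.green q (a n) x y := fun y m n hmn =>
    hq.green_anti (ha0 n) (one_div_le_one_div_of_le (by positivity) (by gcongr)) x y
  have hbdd : ∀ y, BddAbove (Set.range fun n => G.green q (a n) x y) := by
    intro y
    obtain ⟨C, hC⟩ := hb x y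
    exact ⟨C, by rintro _ ⟨n, rfl⟩; exact hC _ (ha0 n) (ha1 n)⟩
  let g : X → ℝ := fun y => ⨆ n, G.green q (a n) x y
  have hg : ∀ y, Tendsto (fun n => G.green q (a n) x y) atTop (𝓝 (g y)) := fun y =>
    tendsto_atTop_ciSup (hmono y) (hbdd y)
  have hle : ∀ n y, G.green q (a n) x y ≤ g y := fun n y => le_ciSup (hbdd y) n
  have hg0 : ∀ y, 0 ≤ g y := fun y => (hq.green_nonneg (ha0 0) x y).trans (hle 0 y)
  have hrhs : ∀ y, Tendsto (fun n => (G.deg y + q y + a n) * G.green q (a n) x y -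
      ellTwoSingle x y) atTop (𝓝 ((G.deg y + q y + 0) * g y - ellTwoSingle x y)) := fun y =>
    ((ha.const_add _).mul (hg y)).sub_const _
  -- The Fatou bound makes the increasing limit itself summable, so it can dominate the sequence;
  -- this gives an equation, not only an inequality.
  have hsum : ∀ y, Summable fun z => G.b y z * g z := fun y =>
    (summable_and_tsum_le_of_tendsto (hrhs y) hg0 hg (Eventually.of_forall fun n =>
      ⟨hq.green_nonneg (ha0 n) x, (hq.green_equation (ha0 n) x y).1,
        (hq.green_equation (ha0 n) x y).2.le⟩)).1
  have htsum : ∀ y, ∑' z, G.b y z * g z = (G.deg y + q y) * g y - ellTwoSingle x y := by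
    intro y
    have h1 := tendsto_tsum_of_dominated_convergence (hsum y)
      (f := fun n z => G.b y z * G.green q (a n) x z) (fun z => (hg z).const_mul (G.b y z))
      (Eventually.of_forall fun n z => by
        rw [Real.norm_of_nonneg (mul_nonneg (G.nonneg _ _) (hq.green_nonneg (ha0 n) x z))]
        exact mul_le_mul_of_nonneg_left (hle n z) (G.nonneg _ _))
    simp only [(hq.green_equation (ha0 _) x y).2] at h1
    rw [tendsto_nhds_unique h1 (hrhs y), add_zero]
  have hF : G.MemF g := memF_of_nonneg hg0 hsum
  have hH : ∀ y, G.schrodinger q g y = ellTwoSingle x y := fun y => by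
    rw [hF.schrodinger_eq, htsum]; ring
  refine ⟨g, ⟨⟨hg0, fun h => ?_⟩, hF, fun y => ?_⟩, hH⟩
  · have h1 := (hq.green_self_pos (ha0 0) x).trans_le (hle 0 x)
    rw [h] at h1
    exact lt_irrefl _ h1
  · rw [hH]; exact ellTwoSingle_nonneg x y

/-- Applying `H` to a finite relation among the `g x` gives the same relation among the functions
`1_{x}`. -/
theorem linearIndependent_of_schrodinger_eq {g : X → X → ℝ} (hF : ∀ x, G.MemF (g x))
    (hg : ∀ x y, G.schrodinger q (g x) y = ellTwoSingle x y) : LinearIndependent ℝ g := by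
  classical
  rw [linearIndependent_iff']
  intro s c hs y hy
  have hz : ∀ z, ∑ x ∈ s, c x * g x z = 0 := fun z => by
    simpa [Finset.sum_apply] using congrFun hs z
  have h1 : ∑ x ∈ s, c x * G.schrodinger q (g x) y = 0 := by
    have h2 : ∑ x ∈ s, c x * ∑' z, G.b y z * g x z = 0 := by
      simp only [← tsum_mul_left]
      rw [← Summable.tsum_finsetSum fun x _ => ((hF x).summable y).mul_left (c x)]
      have : ∀ z, ∑ x ∈ s, c x * (G.b y z * g x z) = 0 := fun z => by
        rw [← mul_zero (G.b y z), ← hz z, Finset.mul_sum]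
        exact Finset.sum_congr rfl fun x _ => by ring
      simp only [this, tsum_zero]
    calc _ = (G.deg y + q y) * ∑ x ∈ s, c x * g x y -
          ∑ x ∈ s, c x * ∑' z, G.b y z * g x z := by
          rw [Finset.mul_sum, ← Finset.sum_sub_distrib]
          exact Finset.sum_congr rfl fun x _ => by rw [(hF x).schrodinger_eq]; ring
      _ = 0 := by rw [hz, h2]; ring
  simp only [hg] at h1
  rw [Finset.sum_eq_single_of_mem y hy fun x _ hxy => by
    simp [ellTwoSingle, Finsupp.single_eq_of_ne hxy.symm]] at h1
  simpa [ellTwoSingle] using h1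

end WeightedGraph

/-! ### The equivalences -/

theorem mainTheorem1 {X : Type*} [Infinite X] (G : WeightedGraph X) (hG : G.Connected)
    (q : X → ℝ) (hq : G.FormNonneg q) :
    List.TFAE
      [ -- (i)
        G.Critical q,
        -- (ii), for some and for all vertices
        ∃ x y, Tendsto (fun lam : ℝ => G.resolventKernel q lam x y) (𝓝[<] 0) atTop,
        ∀ x y, Tendsto (fun lam : ℝ => G.resolventKernel q lam x y) (𝓝[<] 0) atTop,
        -- (ii'), for some and for all vertices
        ∃ x y, Tendsto (fun t : ℝ => ∫ s in (0 : ℝ)..t, G.heatKernel q s x y) atTop atTop,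
        ∀ x y, Tendsto (fun t : ℝ => ∫ s in (0 : ℝ)..t, G.heatKernel q s x y) atTop atTop,
        -- (iii)
        ∃ u, G.IsPosSuperharmonic q u ∧
          ∀ v, G.IsPosSuperharmonic q v → ∃ c : ℝ, v = c • u,
        -- (iii')
        ∀ S : Set (X → ℝ), (∀ u ∈ S, G.IsPosSuperharmonic q u) →
          LinearIndepOn ℝ id S → S.Finite,
        -- (iv)
        ∀ (o : X) (c : ℝ), 0 < c → ∃ e, G.IsNullSequence q e ∧ ∀ n, e n o = c,
        -- (iv')
        ∃ v, IsPositiveFun v ∧ G.IsHarmonic q v ∧ ∃ e, G.IsNullSequence q e ∧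
          (∀ n x, 0 ≤ e n x ∧ e n x ≤ v x) ∧
          ∀ x, Tendsto (fun n => e n x) atTop (𝓝 (v x)),
        -- (v)
        ∀ x, G.capacity q x = 0 ] ∧
    (G.Critical q →
      ∃ u, IsPositiveFun u ∧ G.IsHarmonic q u ∧
        ∀ v, G.IsPosSuperharmonic q v → ∃ c : ℝ, 0 < c ∧ v = c • u) := by
  have hcrit : G.Critical q ↔ ∀ x y, ¬ G.GreenBounded q x y := by
    rw [WeightedGraph.critical_iff]
    refine ⟨fun h x y hxy => h x ?_, fun h x hx => h x x ((hq.pointBound_iff_greenBounded x).1 hx)⟩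
    exact (hq.pointBound_iff_greenBounded x).2 (hq.greenBounded_of hG hxy x x)
  have hsome : (∃ x y, ¬ G.GreenBounded q x y) ↔ ∀ x y, ¬ G.GreenBounded q x y := by
    constructor
    · rintro ⟨x, y, h⟩ x' y' h'
      exact h (hq.greenBounded_of hG h' x y)
    · intro h
      obtain ⟨x⟩ := (inferInstance : Nonempty X)
      exact ⟨x, x, h x x⟩
  have hpoint : ∀ o, ¬ G.PointBound q o → G.Critical q := by
    intro o ho
    rw [hq.pointBound_iff_greenBounded] at ho
    exact hcrit.2 (hsome.1 ⟨o, o, ho⟩)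
  have hnull : ∀ e, G.IsNullSequence q e → G.Critical q := by
    intro e he
    obtain ⟨o, h, c, hc, hco⟩ := he.exists_not_pointBound
    exact hpoint o (h c hc hco)
  obtain ⟨u, hu⟩ := hq.exists_isPosSuperharmonic hG
  refine ⟨?_, fun hc => ⟨u, hu.1, hu.isHarmonic hG hc, fun v hv => hu.eq_smul hq hG hc hv⟩⟩
  -- Items 2–5 become statements about `GreenBounded`, and item 10 one about `PointBound`.
  simp only [← hq.not_greenBounded_iff, ← hq.not_greenBounded_iff_integral,
    hq.capacity_eq_zero_iff]
  tfae_have 1 ↔ 3 := hcrit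
  tfae_have 2 ↔ 3 := hsome
  tfae_have 4 ↔ 3 := hsome
  tfae_have 5 ↔ 3 := Iff.rfl
  tfae_have 1 → 6 := fun hc => ⟨u, hu, fun v hv => by
    obtain ⟨c, -, h⟩ := hu.eq_smul hq hG hc hv
    exact ⟨c, h⟩⟩
  tfae_have 6 → 7 := by
    rintro ⟨w, -, h⟩ S hS hlin
    refine Set.not_infinite.1 fun hinf => ?_
    obtain ⟨f, hf, g, hg, hfg⟩ := hinf.nontrivial
    obtain ⟨a, rfl⟩ := h f (hS f hf)
    obtain ⟨b, rfl⟩ := h g (hS g hg)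
    have ha : a ≠ 0 := fun h0 => (hS _ hf).1.2 (by simp [h0])
    have hpair := (LinearIndepOn.pair_iff id hfg).1 (hlin.mono (Set.pair_subset hf hg))
    exact ha (neg_eq_zero.1 (hpair b (-a) (by simp only [id]; module)).2)
  tfae_have 7 → 1 := by
    intro h
    by_contra hc
    have hb : ∀ x y, G.GreenBounded q x y := by
      by_contra hne
      simp only [not_forall] at hne
      exact hc (hcrit.2 (hsome.1 hne))
    -- One independent Green function per vertex: here the infinitude of `X` is essential.
    choose g hg hg' using hq.exists_greenFunction hb
    have hlin := WeightedGraph.linearIndependent_of_schrodinger_eq (fun x => (hg x).2.1) hg'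
    exact Set.infinite_range_of_injective hlin.injective
      (h _ (by rintro _ ⟨x, rfl⟩; exact hg x) hlin.linearIndepOn_id)
  tfae_have 1 → 8 := fun hc o c hpos =>
    hq.exists_nullSequence (WeightedGraph.critical_iff.1 hc o) hpos
  tfae_have 8 → 1 := by
    intro h
    obtain ⟨o⟩ := (inferInstance : Nonempty X)
    obtain ⟨e, he, -⟩ := h o 1 one_pos
    exact hnull e he
  tfae_have 1 → 9 := fun hc =>
    ⟨u, hu.1, hu.isHarmonic hG hc, hq.exists_dominated_nullSequence hG hc hu⟩
  tfae_have 9 → 1 := fun ⟨_, _, _, e, he, _⟩ => hnull e he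
  tfae_have 1 ↔ 10 := WeightedGraph.critical_iff
  tfae_finish

end
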